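/- Let $V$ be a finite set with $n$ elements, let $E$ be the set of all unordered pairs $xy=\{x,y\}$ of distinct elements of $V$, and let $G$ be a weighted graph on $V$, i.e. a family of weights $c_{xy}\ge 0$ $(xy\in E)$ such that the graph on $V$ whose edges are the pairs $xy$ with $c_{xy}>0$ is connected. The random walk on $G$ is the continuous-time Markov chain with state space $V$ and generator $$\mathcal L^{RW}f(x)=\sum_{y\ne x}c_{xy}\,(f(y)-f(x)),\qquad f:V\to\mathbb R,\ x\in V .$$ For $k\in\{1,\dots,n-1\}$, the $k$-particle symmetric exclusion process on $G$ is the continuous-time Markov chain whose state space is the set $S^{EP}$ of all $k$-element subsets $\zeta\subset V$ and whose generator is $$\mathcal L^{EP}f(\zeta)=\sum_{xy\in E}c_{xy}\,(f(\zeta^{xy})-f(\zeta)),\qquad f:S^{EP}\to\mathbb R,\ \zeta\in S^{EP},$$ where $\zeta^{xy}=(\zeta\setminus\{y\})\cup\{x\}$ if $y\in\zeta$ and $x\notin\zeta$, $\zeta^{xy}=(\zeta\setminus\{x\})\cup\{y\}$ if $x\in\zeta$ and $y\notin\zeta$, and $\zeta^{xy}=\zeta$ otherwise. For a chain with generator $\mathcal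 L$ (symmetric, on a finite state space with at least two elements), let $\lambda_0\le\lambda_1\le\cdots$ be the eigenvalues of $-\mathcal L$, counted with multiplicity; its spectral gap is $\lambda_1$. Then for every such weighted graph $G$ and every $k=1,\dots,n-1$, the $k$-particle symmetric exclusion process and the random walk have the same spectral gap: $$\lambda_1^{EP}(G)=\lambda_1^{RW}(G).$$ -/

import Mathlib

/-- A weighted graph on the vertex set `V`: the complete graph on `V` with a conductance
`c s(x, y) ≥ 0` on every edge `s(x, y)`, `x ≠ y`, such that the edges of positive conductance form
a connected graph.  (Values of `c` on the diagonal of `Sym2 V` are never used.) -/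
structure WeightedGraph (V : Type*) where
  /-- the conductances -/
  c : Sym2 V → ℝ
  nonneg : ∀ x y : V, x ≠ y → 0 ≤ c s(x, y)
  connected : (SimpleGraph.fromRel fun x y : V => 0 < c s(x, y)).Connected

/-- The eigenvalues of `-L`, listed in increasing order `λ₀ ≤ λ₁ ≤ …` and repeated according to
their multiplicity, where `L` is the generator of a Markov chain with finite state space `S`
(acting on the functions `S → ℝ`). -/
noncomputable def gapSpectrum {S : Type*} [Fintype S] (L : (S → ℝ) →ₗ[ℝ] (S → ℝ)) : List ℝ :=
  (-L).charpoly.roots.sort (· ≤ ·)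

/-- The spectral gap of the chain with generator `L`: the entry `λ₁` of the increasing list
`λ₀ ≤ λ₁ ≤ …` of all eigenvalues of `-L`.  (The default value is irrelevant as soon as a reversible
chain has at least two states.) -/
noncomputable def spectralGap {S : Type*} [Fintype S] (L : (S → ℝ) →ₗ[ℝ] (S → ℝ)) : ℝ :=
  (gapSpectrum L).getD 1 0

/-- The configuration `ζ^{xy}`: if exactly one of `x`, `y` is occupied in `ζ`, the particle there
jumps to the other site; otherwise nothing happens. -/
def exchangePair {V : Type*} [DecidableEq V] (ζ : Finset V) (x y : V) : Finset V :=
  if y ∈ ζ ∧ x ∉ ζ then insert x (ζ.erase y)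
  else if x ∈ ζ ∧ y ∉ ζ then insert y (ζ.erase x)
  else ζ

theorem exchangePair_comm {V : Type*} [DecidableEq V] (ζ : Finset V) (x y : V) :
    exchangePair ζ x y = exchangePair ζ y x := by
  unfold exchangePair
  by_cases hx : x ∈ ζ <;> by_cases hy : y ∈ ζ <;> simp [hx, hy]

theorem card_exchangePair {V : Type*} [DecidableEq V] (ζ : Finset V) (x y : V) :
    (exchangePair ζ x y).card = ζ.card := by
  unfold exchangePair
  split_ifs with h₁ h₂
  · rw [Finset.card_insert_of_notMem (by simp [h₁.2]), Finset.card_erase_add_one h₁.1]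
  · rw [Finset.card_insert_of_notMem (by simp [h₂.2]), Finset.card_erase_add_one h₂.1]
  · rfl

/-- The states of the `k`-particle exclusion process: the sets of `k` (occupied) vertices. -/
abbrev ExclusionState (V : Type*) (k : ℕ) : Type _ := {ζ : Finset V // ζ.card = k}

/-- The state `ζ^{e}` for an unordered pair `e = s(x, y)`. -/
def exchange {V : Type*} [DecidableEq V] {k : ℕ} (ζ : ExclusionState V k) (e : Sym2 V) :
    ExclusionState V k :=
  Sym2.lift ⟨fun x y => ⟨exchangePair ζ.1 x y, (card_exchangePair ζ.1 x y).trans ζ.2⟩,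
    fun x y => Subtype.ext (exchangePair_comm ζ.1 x y)⟩ e

/-- The generator of the random walk on `G`:
`(L f)(x) = ∑_{y ≠ x} c_{xy} (f(y) - f(x))`. -/
def WeightedGraph.randomWalkGenerator {V : Type*} [Fintype V] [DecidableEq V]
    (G : WeightedGraph V) : (V → ℝ) →ₗ[ℝ] (V → ℝ) where
  toFun f x := ∑ y ∈ Finset.univ.erase x, G.c s(x, y) * (f y - f x)
  map_add' f g := by
    funext x
    simp only [Pi.add_apply, ← Finset.sum_add_distrib]
    exact Finset.sum_congr rfl fun y _ => by ring
  map_smul' r f := by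
    funext x
    simp only [Pi.smul_apply, smul_eq_mul, RingHom.id_apply, Finset.mul_sum]
    exact Finset.sum_congr rfl fun y _ => by ring

/-- The generator of the `k`-particle symmetric exclusion process on `G`:
`(L f)(ζ) = ∑_{xy ∈ E} c_{xy} (f(ζ^{xy}) - f(ζ))`, where `E` is the edge set of the complete
graph on `V`. -/
def WeightedGraph.exclusionGenerator {V : Type*} [Fintype V] [DecidableEq V]
    (G : WeightedGraph V) (k : ℕ) : (ExclusionState V k → ℝ) →ₗ[ℝ] (ExclusionState V k → ℝ) where
  toFun f ζ := ∑ e ∈ (⊤ : SimpleGraph V).edgeFinset, G.c e * (f (exchange ζ e) - f ζ)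
  map_add' f g := by
    funext ζ
    simp only [Pi.add_apply, ← Finset.sum_add_distrib]
    exact Finset.sum_congr rfl fun e _ => by ring
  map_smul' r f := by
    funext ζ
    simp only [Pi.smul_apply, smul_eq_mul, RingHom.id_apply, Finset.mul_sum]
    exact Finset.sum_congr rfl fun e _ => by ring

/-! Upper bound on the exclusion gap: if `φ` is a walk eigenfunction, `ζ ↦ ∑_{v ∈ ζ} φ v` is an
eigenfunction of the exclusion process for the same eigenvalue (`exclusionGenerator_configLift`),
and for `1 ≤ k ≤ n - 1` it is not constant.

Lower bound (`exclusionPoincare_fin`): all particle numbers are treated together, by induction on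
the number of vertices. Let `g` be an exclusion eigenfunction with zero sum in every particle-number
sector. Its sums over configurations occupied at `x` form, as `x` varies, a zero-sum function that
the walk generator multiplies by the same eigenvalue. If this is nonzero for some sector, the walk
gap bounds the eigenvalue. Otherwise the two slices of `g` with vertex `0` occupied and vacant are
again zero-sum in every sector. Vertex `0` is then removed and each pair `i, j` receives the extra
conductance `c₀ᵢ c₀ⱼ / ∑ₗ c₀ₗ`. The walk Poincaré constant survives by harmonic extension
(`walkPoincare_reduced`), and the slices have no more energy than `g`
(`exclusionEnergy_reduced_le`); this last fact is the octopus inequality.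

The octopus inequality says that `D = ∑ c_x c_y ρ(x y)` is positive semidefinite when `∑ c = 0` and
`c ≥ 0` off one vertex `o`. Expanding the square gives `‖D f‖² = 2 (∑ c²) ⟪f, D f⟫ + Q`, where `Q`
sums `⟪f, quad f⟫ / 6` over distinct quadruples with product weights (`quadSum_swapCorr`). Since
`quad / 12` is an orthogonal projection, a five-point comparison (`inner_quad_le`) yields `Q ≤ 0`,
hence `0 ≤ ⟪f, D f⟫` unless `c` vanishes. -/

open Equiv (Perm swap)
open scoped RealInnerProductSpace

/-! ### Group-ring identities on four and five points. -/

/-- The image under `ρ` of the two `3`-cycles on `{a, b, c}`. -/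
def threeCycles {V R : Type*} [DecidableEq V] [Ring R] (ρ : Perm V →* R) (a b c : V) : R :=
  ρ (swap a b * swap b c) + ρ (swap b c * swap a b)

/-- The image under `ρ` of the element `2 + 2 ∑ (double transpositions) - ∑ (3-cycles)` of the group
ring of the alternating group of `{a, b, c, d}`. -/
def quad {V R : Type*} [DecidableEq V] [Ring R] (ρ : Perm V →* R) (a b c d : V) : R :=
  2 + 2 * (ρ (swap a b * swap c d) + ρ (swap a c * swap b d) + ρ (swap a d * swap b c)) -
    (threeCycles ρ a b c + threeCycles ρ a b d + threeCycles ρ a c d + threeCycles ρ b c d)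

/-- Extension of permutations along an embedding. -/
noncomputable def permEmbed {W V : Type*} (v : W ↪ V) : Perm W →* Perm V :=
  Equiv.Perm.viaEmbeddingHom v

theorem permEmbed_swap {W V : Type*} [DecidableEq W] [DecidableEq V] (v : W ↪ V) (i j : W) :
    permEmbed v (swap i j) = swap (v i) (v j) := by
  ext x
  by_cases hx : x ∈ Set.range v
  · obtain ⟨k, rfl⟩ := hx
    rw [permEmbed, Equiv.Perm.viaEmbeddingHom_apply, Equiv.Perm.viaEmbedding_apply,
      Function.Injective.map_swap v.injective]
  · rw [permEmbed, Equiv.Perm.viaEmbeddingHom_apply,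
      Equiv.Perm.viaEmbedding_apply_of_notMem _ _ _ hx, Equiv.swap_apply_of_ne_of_ne]
    · rintro rfl; exact hx ⟨_, rfl⟩
    · rintro rfl; exact hx ⟨_, rfl⟩

theorem quad_comp_permEmbed {W V R : Type*} [DecidableEq W] [DecidableEq V] [Ring R]
    (ρ : Perm V →* R) (v : W ↪ V) (i j k l : W) :
    quad (ρ.comp (permEmbed v)) i j k l = quad ρ (v i) (v j) (v k) (v l) := by
  simp only [quad, threeCycles, MonoidHom.comp_apply, map_mul, permEmbed_swap]

/-- The alternating group is the Klein group extended by a 3-cycle `c`, and `quad` factors as (sum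
of the Klein group) times `2 - c - c²`. The first factor absorbs Klein elements; the second is
killed by `1 + c + c²`. -/
theorem quad_fin_four_absorb {R : Type*} [Ring R] (ρ : Perm (Fin 4) →* R) :
    ρ (swap 0 1 * swap 2 3) * quad ρ 0 1 2 3 = quad ρ 0 1 2 3 ∧
    ρ (swap 0 2 * swap 1 3) * quad ρ 0 1 2 3 = quad ρ 0 1 2 3 ∧
    ρ (swap 0 3 * swap 1 2) * quad ρ 0 1 2 3 = quad ρ 0 1 2 3 ∧
    (threeCycles ρ 0 1 2 + threeCycles ρ 0 1 3 + threeCycles ρ 0 2 3 + threeCycles ρ 1 2 3) *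
      quad ρ 0 1 2 3 = -4 * quad ρ 0 1 2 3 := by
  obtain ⟨X, hX⟩ : ∃ X : Perm (Fin 4), X = swap 0 1 * swap 2 3 := ⟨_, rfl⟩
  obtain ⟨Y, hY⟩ : ∃ Y : Perm (Fin 4), Y = swap 0 2 * swap 1 3 := ⟨_, rfl⟩
  obtain ⟨C, hC⟩ : ∃ C : Perm (Fin 4), C = swap 0 1 * swap 1 2 := ⟨_, rfl⟩
  -- From here only a presentation of the alternating group matters: every permutation is written in
  -- `X`, `Y`, `C`, and the rest is algebra in `R`.
  have hXX : ρ X * ρ X = 1 := by rw [← map_mul, ← map_one ρ]; congr 1; subst hX; decide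
  have hYY : ρ Y * ρ Y = 1 := by rw [← map_mul, ← map_one ρ]; congr 1; subst hY; decide
  have hYX : ρ Y * ρ X = ρ X * ρ Y := by
    rw [← map_mul, ← map_mul]; congr 1; subst hX hY; decide
  have hCCC : ρ C * (ρ C * ρ C) = 1 := by
    rw [← map_mul, ← map_mul, ← map_one ρ]; congr 1; subst hC; decide
  have hCX : ρ C * ρ X = ρ X * ρ Y * ρ C := by
    simp only [← map_mul]; congr 1; subst hX hY hC; decide
  have hCY : ρ C * ρ Y = ρ X * ρ C := by
    simp only [← map_mul]; congr 1; subst hX hY hC; decide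
  have h1 : ρ (swap 0 1 * swap 2 3) = ρ X := by rw [hX]
  have h2 : ρ (swap 0 2 * swap 1 3) = ρ Y := by rw [hY]
  have h3 : ρ (swap 0 3 * swap 1 2) = ρ X * ρ Y := by
    simp only [← map_mul]; congr 1; subst hX hY; decide
  have g1 : ρ (swap 0 1 * swap 1 2) = ρ C := by rw [hC]
  have g2 : ρ (swap 1 2 * swap 0 1) = ρ C * ρ C := by
    simp only [← map_mul]; congr 1; subst hC; decide
  have g3 : ρ (swap 0 1 * swap 1 3) = ρ X * ρ Y * (ρ C * ρ C) := by
    simp only [← map_mul]; congr 1; subst hX hY hC; decide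
  have g4 : ρ (swap 1 3 * swap 0 1) = ρ Y * ρ C := by
    simp only [← map_mul]; congr 1; subst hY hC; decide
  have g5 : ρ (swap 0 2 * swap 2 3) = ρ X * ρ Y * ρ C := by
    simp only [← map_mul]; congr 1; subst hX hY hC; decide
  have g6 : ρ (swap 2 3 * swap 0 2) = ρ X * (ρ C * ρ C) := by
    simp only [← map_mul]; congr 1; subst hX hC; decide
  have g7 : ρ (swap 1 2 * swap 2 3) = ρ Y * (ρ C * ρ C) := by
    simp only [← map_mul]; congr 1; subst hY hC; decide
  have g8 : ρ (swap 2 3 * swap 1 2) = ρ X * ρ C := by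
    simp only [← map_mul]; congr 1; subst hX hC; decide
  generalize ρ X = x at *
  generalize ρ Y = y at *
  generalize ρ C = c at *
  have hU : threeCycles ρ 0 1 2 + threeCycles ρ 0 1 3 + threeCycles ρ 0 2 3 +
      threeCycles ρ 1 2 3 = (1 + x + y + x * y) * (c + c * c) := by
    simp only [threeCycles, g1, g2, g3, g4, g5, g6, g7, g8]
    noncomm_ring
  have he : quad ρ 0 1 2 3 = (1 + x + y + x * y) * (2 - c - c * c) := by
    rw [quad, hU, h1, h2, h3, ← one_add_one_eq_two]
    noncomm_ring
  rw [he, hU, h1, h2, h3]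
  have hxv : x * (1 + x + y + x * y) = 1 + x + y + x * y := by
    simp only [mul_add, ← mul_assoc, hXX, mul_one, one_mul]; abel
  have hyv : y * (1 + x + y + x * y) = 1 + x + y + x * y := by
    simp only [mul_add, ← mul_assoc, hYX, mul_one]
    rw [mul_assoc x y y, hYY, mul_one]; abel
  have hcv : c * (1 + x + y + x * y) = (1 + x + y + x * y) * c := by
    have : c * (x * y) = y * c := by
      rw [← mul_assoc, hCX, mul_assoc, hCY, mul_assoc x y, ← mul_assoc y, hYX, ← mul_assoc,
        ← mul_assoc, hXX, one_mul]
    simp only [mul_add, add_mul, mul_one, one_mul, hCX, hCY, this]; abel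
  have hw : c * (2 - c - c * c) = 2 * c - c * c - 1 := by
    rw [mul_sub, mul_sub, hCCC]; noncomm_ring
  have hw' : c * (2 * c - c * c - 1) = 2 * (c * c) - 1 - c := by
    rw [mul_sub, mul_sub, hCCC]; noncomm_ring
  generalize hv : 1 + x + y + x * y = v at *
  refine ⟨by rw [← mul_assoc, hxv], by rw [← mul_assoc, hyv],
    by rw [← mul_assoc, mul_assoc x, hyv, hxv], ?_⟩
  have hce : c * (v * (2 - c - c * c)) = v * (2 * c - c * c - 1) := by
    rw [← mul_assoc, hcv, mul_assoc, hw]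
  have hcce : c * c * (v * (2 - c - c * c)) = v * (2 * (c * c) - 1 - c) := by
    rw [mul_assoc, hce, ← mul_assoc, hcv, mul_assoc, hw']
  have hvv : v * v = 4 * v := by
    nth_rw 1 [← hv]
    simp only [add_mul, one_mul, mul_assoc, hyv, hxv]; noncomm_ring
  rw [mul_assoc, add_mul, hce, hcce, ← mul_add, ← mul_assoc, hvv]
  noncomm_ring

theorem exists_embedding_four {V : Type*} {a b c d : V} (hab : a ≠ b) (hac : a ≠ c) (had : a ≠ d)
    (hbc : b ≠ c) (hbd : b ≠ d) (hcd : c ≠ d) :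
    ∃ v : Fin 4 ↪ V, v 0 = a ∧ v 1 = b ∧ v 2 = c ∧ v 3 = d := by
  refine ⟨⟨![a, b, c, d], ?_⟩, rfl, rfl, rfl, rfl⟩
  intro i j
  fin_cases i <;> fin_cases j <;> simp [hab, hac, had, hbc, hbd, hcd, Ne.symm]

theorem exists_embedding_five {V : Type*} {o a b c d : V} (hoa : o ≠ a) (hob : o ≠ b)
    (hoc : o ≠ c) (hod : o ≠ d) (hab : a ≠ b) (hac : a ≠ c) (had : a ≠ d)
    (hbc : b ≠ c) (hbd : b ≠ d) (hcd : c ≠ d) :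
    ∃ v : Fin 5 ↪ V, v 0 = o ∧ v 1 = a ∧ v 2 = b ∧ v 3 = c ∧ v 4 = d := by
  refine ⟨⟨![o, a, b, c, d], ?_⟩, rfl, rfl, rfl, rfl, rfl⟩
  intro i j
  fin_cases i <;> fin_cases j <;> simp [hoa, hob, hoc, hod, hab, hac, had, hbc, hbd, hcd, Ne.symm]

theorem quad_absorb {V R : Type*} [DecidableEq V] [Ring R] (ρ : Perm V →* R) {a b c d : V}
    (hab : a ≠ b) (hac : a ≠ c) (had : a ≠ d) (hbc : b ≠ c) (hbd : b ≠ d) (hcd : c ≠ d) :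
    ρ (swap a b * swap c d) * quad ρ a b c d = quad ρ a b c d ∧
    ρ (swap a c * swap b d) * quad ρ a b c d = quad ρ a b c d ∧
    ρ (swap a d * swap b c) * quad ρ a b c d = quad ρ a b c d ∧
    (threeCycles ρ a b c + threeCycles ρ a b d + threeCycles ρ a c d + threeCycles ρ b c d) *
      quad ρ a b c d = -4 * quad ρ a b c d := by
  obtain ⟨v, rfl, rfl, rfl, rfl⟩ := exists_embedding_four hab hac had hbc hbd hcd
  have h := quad_fin_four_absorb (ρ.comp (permEmbed v))
  simpa only [quad_comp_permEmbed, threeCycles, MonoidHom.comp_apply, map_mul, permEmbed_swap]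
    using h

theorem quad_mul_self {V R : Type*} [DecidableEq V] [Ring R] (ρ : Perm V →* R) {a b c d : V}
    (hab : a ≠ b) (hac : a ≠ c) (had : a ≠ d) (hbc : b ≠ c) (hbd : b ≠ d) (hcd : c ≠ d) :
    quad ρ a b c d * quad ρ a b c d = 12 * quad ρ a b c d := by
  obtain ⟨h1, h2, h3, h4⟩ := quad_absorb ρ hab hac had hbc hbd hcd
  nth_rw 1 [quad]
  rw [sub_mul, h4, add_mul, mul_assoc, add_mul, add_mul, h1, h2, h3]
  noncomm_ring

/-- Against `quad ρ 1 2 3 4`, each double transposition moving `0` equals a 3-cycle through `0`, up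
to a Klein element that is absorbed. The twelve double transpositions (coefficient `2`) then cancel
the twelve 3-cycles through `0` (each in two summands). The constants give `8` and the 3-cycles
avoiding `0` give `4`. -/
theorem quad_fin_five_sum_mul {R : Type*} [Ring R] (ρ : Perm (Fin 5) →* R) :
    (quad ρ 0 2 3 4 + quad ρ 0 1 3 4 + quad ρ 0 1 2 4 + quad ρ 0 1 2 3) * quad ρ 1 2 3 4 =
      12 * quad ρ 1 2 3 4 := by
  obtain ⟨h1, h2, h3, h4⟩ := quad_absorb ρ (a := (1 : Fin 5)) (b := 2) (c := 3) (d := 4)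
    (by decide) (by decide) (by decide) (by decide) (by decide) (by decide)
  have key : ∀ (p q r : Perm (Fin 5)), p = q * r → ρ r * quad ρ 1 2 3 4 = quad ρ 1 2 3 4 →
      ρ p * quad ρ 1 2 3 4 = ρ q * quad ρ 1 2 3 4 := by
    rintro p q r rfl h
    rw [map_mul, mul_assoc, h]
  have k21 := key (swap 0 2 * swap 3 4) (swap 1 2 * swap 0 1) _ (by decide) h1
  have k31 := key (swap 0 3 * swap 2 4) (swap 1 3 * swap 0 1) _ (by decide) h2
  have k41 := key (swap 0 4 * swap 2 3) (swap 1 4 * swap 0 1) _ (by decide) h3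
  have k12 := key (swap 0 1 * swap 3 4) (swap 0 1 * swap 1 2) _ (by decide) h1
  have k32 := key (swap 0 3 * swap 1 4) (swap 2 3 * swap 0 2) _ (by decide) h3
  have k42 := key (swap 0 4 * swap 1 3) (swap 2 4 * swap 0 2) _ (by decide) h2
  have k13 := key (swap 0 1 * swap 2 4) (swap 0 1 * swap 1 3) _ (by decide) h2
  have k23 := key (swap 0 2 * swap 1 4) (swap 0 2 * swap 2 3) _ (by decide) h3
  have k43 := key (swap 0 4 * swap 1 2) (swap 3 4 * swap 0 3) _ (by decide) h1
  have k14 := key (swap 0 1 * swap 2 3) (swap 0 1 * swap 1 4) _ (by decide) h3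
  have k24 := key (swap 0 2 * swap 1 3) (swap 0 2 * swap 2 4) _ (by decide) h2
  have k34 := key (swap 0 3 * swap 1 2) (swap 0 3 * swap 3 4) _ (by decide) h1
  generalize quad ρ 1 2 3 4 = e at *
  have hU : (threeCycles ρ 1 2 3 + threeCycles ρ 1 2 4 + threeCycles ρ 1 3 4 + threeCycles ρ 2 3 4)
      * e = -4 * e := h4
  simp only [quad, add_mul, sub_mul, mul_assoc, k21, k31, k41, k12, k32, k42, k13,
    k23, k43, k14, k24, k34]
  simp only [add_mul] at hU
  simp only [threeCycles, add_mul] at hU ⊢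
  have t2 : ∀ t : R, 2 * t = (2 : ℤ) • t := fun t => by simp
  have t4 : ∀ t : R, -4 * t = (-4 : ℤ) • t := fun t => by simp
  have t12 : ∀ t : R, 12 * t = (12 : ℤ) • t := fun t => by simp
  simp only [t2, t4, t12] at hU ⊢
  linear_combination (norm := module) (-1 : ℤ) • hU

/-! ### Positivity of `quad` in orthogonal representations. -/

section Orthogonal

variable {V E : Type*} [NormedAddCommGroup E] [InnerProductSpace ℝ E]
  {ρ : Perm V →* Module.End ℝ E}

theorem inner_apply_left (hρ : ∀ σ x y, ⟪ρ σ x, ρ σ y⟫ = ⟪x, y⟫) (σ : Perm V) (x y : E) :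
    ⟪ρ σ x, y⟫ = ⟪x, ρ σ⁻¹ y⟫ := by
  rw [← hρ σ x (ρ σ⁻¹ y), ← Module.End.mul_apply, ← map_mul, mul_inv_cancel, map_one,
    Module.End.one_apply]

variable [DecidableEq V]

/-- The coefficients are invariant under inversion: double transpositions are involutions and
3-cycles come with their inverses. -/
theorem inner_quad_left (hρ : ∀ σ x y, ⟪ρ σ x, ρ σ y⟫ = ⟪x, y⟫) {a b c d : V}
    (hab : a ≠ b) (hac : a ≠ c) (had : a ≠ d) (hbc : b ≠ c) (hbd : b ≠ d) (hcd : c ≠ d)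
    (x y : E) : ⟪quad ρ a b c d x, y⟫ = ⟪x, quad ρ a b c d y⟫ := by
  have comm : ∀ {p q r s : V}, p ≠ r → p ≠ s → q ≠ r → q ≠ s →
      (swap p q * swap r s)⁻¹ = swap p q * swap r s := by
    intro p q r s h1 h2 h3 h4
    rw [mul_inv_rev, Equiv.swap_inv, Equiv.swap_inv]
    ext t
    simp only [Equiv.Perm.mul_apply, Equiv.swap_apply_def]
    split_ifs <;> simp_all
  have e1 := comm hac had hbc hbd
  have e2 := comm hab had hbc.symm hcd
  have e3 := comm hab hac hbd.symm hcd.symm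
  have h2 : ∀ z : E, (2 : Module.End ℝ E) z = (2 : ℝ) • z := fun z => by
    rw [← one_add_one_eq_two, two_smul]; rfl
  simp only [quad, threeCycles, LinearMap.sub_apply, LinearMap.add_apply, Module.End.mul_apply,
    h2, inner_sub_left, inner_sub_right, inner_add_left, inner_add_right, inner_smul_left,
    inner_smul_right, inner_apply_left hρ, e1, e2, e3]
  simp only [mul_inv_rev, Equiv.swap_inv, RCLike.conj_to_real]
  ring

theorem norm_quad_sq (hρ : ∀ σ x y, ⟪ρ σ x, ρ σ y⟫ = ⟪x, y⟫) {a b c d : V}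
    (hab : a ≠ b) (hac : a ≠ c) (had : a ≠ d) (hbc : b ≠ c) (hbd : b ≠ d) (hcd : c ≠ d)
    (x : E) : ‖quad ρ a b c d x‖ ^ 2 = 12 * ⟪x, quad ρ a b c d x⟫ := by
  have h12 : ∀ z : E, (12 : Module.End ℝ E) z = (12 : ℝ) • z := fun z => by
    rw [show (12 : Module.End ℝ E) = ((12 : ℕ) : Module.End ℝ E) from rfl,
      Module.End.natCast_apply, ← Nat.cast_smul_eq_nsmul ℝ]; norm_num
  rw [← real_inner_self_eq_norm_sq, inner_quad_left hρ hab hac had hbc hbd hcd,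
    ← Module.End.mul_apply, quad_mul_self ρ hab hac had hbc hbd hcd, Module.End.mul_apply, h12,
    inner_smul_right]

theorem inner_quad_nonneg (hρ : ∀ σ x y, ⟪ρ σ x, ρ σ y⟫ = ⟪x, y⟫) {a b c d : V}
    (hab : a ≠ b) (hac : a ≠ c) (had : a ≠ d) (hbc : b ≠ c) (hbd : b ≠ d) (hcd : c ≠ d)
    (x : E) : 0 ≤ ⟪x, quad ρ a b c d x⟫ := by
  have := norm_quad_sq hρ hab hac had hbc hbd hcd x
  nlinarith [sq_nonneg ‖quad ρ a b c d x‖]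

/-- Let `S` be the sum of the four operators on the right and `P = e / 12` the projection on the
left. Since `S P = 12 P` and `S` is symmetric, `S` splits along `P`: it is `12` on the range of `P`
and nonnegative on the complement. -/
theorem inner_quad_le (hρ : ∀ σ x y, ⟪ρ σ x, ρ σ y⟫ = ⟪x, y⟫) {o a b c d : V}
    (hoa : o ≠ a) (hob : o ≠ b) (hoc : o ≠ c) (hod : o ≠ d)
    (hab : a ≠ b) (hac : a ≠ c) (had : a ≠ d) (hbc : b ≠ c) (hbd : b ≠ d) (hcd : c ≠ d)
    (f : E) : ⟪f, quad ρ a b c d f⟫ ≤ ⟪f, quad ρ o b c d f⟫ + ⟪f, quad ρ o a c d f⟫ +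
      ⟪f, quad ρ o a b d f⟫ + ⟪f, quad ρ o a b c f⟫ := by
  have hS : (quad ρ o b c d + quad ρ o a c d + quad ρ o a b d + quad ρ o a b c) * quad ρ a b c d =
      12 * quad ρ a b c d := by
    obtain ⟨v, rfl, rfl, rfl, rfl, rfl⟩ :=
      exists_embedding_five hoa hob hoc hod hab hac had hbc hbd hcd
    simpa only [quad_comp_permEmbed] using quad_fin_five_sum_mul (ρ.comp (permEmbed v))
  have n0 := inner_quad_nonneg hρ hab hac had hbc hbd hcd
  have n1 := inner_quad_nonneg hρ hob hoc hod hbc hbd hcd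
  have n2 := inner_quad_nonneg hρ hoa hoc hod hac had hcd
  have n3 := inner_quad_nonneg hρ hoa hob hod hab had hbd
  have n4 := inner_quad_nonneg hρ hoa hob hoc hab hac hbc
  have s0 := inner_quad_left hρ hab hac had hbc hbd hcd
  have s1 := inner_quad_left hρ hob hoc hod hbc hbd hcd
  have s2 := inner_quad_left hρ hoa hoc hod hac had hcd
  have s3 := inner_quad_left hρ hoa hob hod hab had hbd
  have s4 := inner_quad_left hρ hoa hob hoc hab hac hbc
  have hq := quad_mul_self ρ hab hac had hbc hbd hcd
  have h12 : ∀ z : E, (12 : Module.End ℝ E) z = (12 : ℝ) • z := fun z => by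
    rw [show (12 : Module.End ℝ E) = ((12 : ℕ) : Module.End ℝ E) from rfl,
      Module.End.natCast_apply, ← Nat.cast_smul_eq_nsmul ℝ]; norm_num
  generalize quad ρ a b c d = e at *
  generalize quad ρ o b c d = e1 at *
  generalize quad ρ o a c d = e2 at *
  generalize quad ρ o a b d = e3 at *
  generalize quad ρ o a b c = e4 at *
  have hS' := congrArg (fun T : Module.End ℝ E => ⟪f, T f⟫) hS
  have hS'' := congrArg (fun T : Module.End ℝ E => ⟪e f, T f⟫) hS
  have hq' := congrArg (fun T : Module.End ℝ E => ⟪f, T f⟫) hq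
  have hq'' := congrArg (fun T : Module.End ℝ E => ⟪e f, T f⟫) hq
  -- Positivity is used only on the component `f - P f`; the other terms are evaluated exactly by `S
  -- e = 12 e`.
  have m1 := n1 (f - (1 / 12 : ℝ) • e f)
  have m2 := n2 (f - (1 / 12 : ℝ) • e f)
  have m3 := n3 (f - (1 / 12 : ℝ) • e f)
  have m4 := n4 (f - (1 / 12 : ℝ) • e f)
  have c1 := s1 f (e f)
  have c2 := s2 f (e f)
  have c3 := s3 f (e f)
  have c4 := s4 f (e f)
  have d1 := real_inner_comm (e1 f) (e f)
  have d2 := real_inner_comm (e2 f) (e f)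
  have d3 := real_inner_comm (e3 f) (e f)
  have d4 := real_inner_comm (e4 f) (e f)
  have ee := s0 f (e f)
  simp only [Module.End.mul_apply, LinearMap.add_apply, h12, inner_add_right, inner_smul_right]
    at hS' hS'' hq' hq''
  simp only [map_sub, map_smul, inner_sub_left, inner_sub_right, inner_smul_left,
    inner_smul_right, RCLike.conj_to_real] at m1 m2 m3 m4
  linarith

end Orthogonal

/-! ### Correlations of transpositions and their symmetrization. -/

section Octopus

variable {V E : Type*} [DecidableEq V] [NormedAddCommGroup E] [InnerProductSpace ℝ E]

/-- The inner product of the images of `f` under the transpositions `(a b)` and `(c d)`. -/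
noncomputable def swapCorr (ρ : Perm V →* Module.End ℝ E) (f : E) (a b c d : V) : ℝ :=
  ⟪ρ (swap a b) f, ρ (swap c d) f⟫

variable {ρ : Perm V →* Module.End ℝ E} {f : E}

theorem swapCorr_comm_left (a b c d : V) : swapCorr ρ f a b c d = swapCorr ρ f b a c d := by
  rw [swapCorr, Equiv.swap_comm, swapCorr]

theorem swapCorr_comm (a b c d : V) : swapCorr ρ f a b c d = swapCorr ρ f c d a b := by
  rw [swapCorr, real_inner_comm, swapCorr]

theorem swapCorr_comm_right (a b c d : V) : swapCorr ρ f a b c d = swapCorr ρ f a b d c := by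
  rw [swapCorr, Equiv.swap_comm c, swapCorr]

theorem swapCorr_diag (a c d : V) : swapCorr ρ f a a c d = ⟪f, ρ (swap c d) f⟫ := by
  rw [swapCorr, Equiv.swap_self, ← Equiv.Perm.one_def, map_one, Module.End.one_apply]

theorem inner_mul_swap (hρ : ∀ σ x y, ⟪ρ σ x, ρ σ y⟫ = ⟪x, y⟫) (a b c d : V) :
    ⟪f, ρ (swap a b * swap c d) f⟫ = swapCorr ρ f a b c d := by
  rw [swapCorr, inner_apply_left hρ, Equiv.swap_inv, map_mul, Module.End.mul_apply]

theorem swapCorr_self (hρ : ∀ σ x y, ⟪ρ σ x, ρ σ y⟫ = ⟪x, y⟫) (a b : V) :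
    swapCorr ρ f a b a b = ‖f‖ ^ 2 := by
  rw [swapCorr, hρ, real_inner_self_eq_norm_sq]

theorem swapCorr_rotate (hρ : ∀ σ x y, ⟪ρ σ x, ρ σ y⟫ = ⟪x, y⟫) {a b c : V} (hab : a ≠ b)
    (hac : a ≠ c) (hbc : b ≠ c) : swapCorr ρ f a b b c = swapCorr ρ f b c c a := by
  rw [← inner_mul_swap hρ, ← inner_mul_swap hρ]
  congr 3
  ext t
  simp only [Equiv.Perm.mul_apply, Equiv.swap_apply_def]
  split_ifs <;> simp_all

/-- Two different transpositions of a triple multiply to one of its two 3-cycles. These are mutually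
inverse, so they have the same real quadratic form. -/
theorem swapCorr_triple (hρ : ∀ σ x y, ⟪ρ σ x, ρ σ y⟫ = ⟪x, y⟫) {x y z : V} (hxy : x ≠ y)
    (hxz : x ≠ z) (hyz : y ≠ z) :
    swapCorr ρ f x y x z = swapCorr ρ f x y y z ∧ swapCorr ρ f x z x y = swapCorr ρ f x y y z ∧
    swapCorr ρ f x z y z = swapCorr ρ f x y y z := by
  have h1 := swapCorr_rotate (f := f) hρ hxy hxz hyz
  have h2 := swapCorr_rotate (f := f) hρ hyz hxy.symm hxz.symm
  have h3 : swapCorr ρ f x y x z = swapCorr ρ f z x x y := by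
    rw [swapCorr_comm, swapCorr_comm_left]
  have h4 : swapCorr ρ f x z x y = swapCorr ρ f z x x y := swapCorr_comm_left _ _ _ _
  have h5 : swapCorr ρ f x z y z = swapCorr ρ f y z z x := by
    rw [swapCorr_comm, swapCorr_comm_right]
  exact ⟨by rw [h3, ← h2, ← h1], by rw [h4, ← h2, ← h1], by rw [h5, ← h1]⟩

/-- The value of `quad` at `f`, extended by zero to quadruples that are not distinct. -/
noncomputable def quadForm (ρ : Perm V →* Module.End ℝ E) (f : E) (a b c d : V) : ℝ :=
  if a ≠ b ∧ a ≠ c ∧ a ≠ d ∧ b ≠ c ∧ b ≠ d ∧ c ≠ d then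
    ⟪f, quad ρ a b c d f⟫ / 6
  else 0

/-- The correlation along a `3`-cycle, extended by zero to triples that are not distinct. -/
noncomputable def cycleCorr (ρ : Perm V →* Module.End ℝ E) (f : E) (a b c : V) : ℝ :=
  if a ≠ b ∧ a ≠ c ∧ b ≠ c then swapCorr ρ f a b b c else 0

theorem inner_quad (hρ : ∀ σ x y, ⟪ρ σ x, ρ σ y⟫ = ⟪x, y⟫) (a b c d : V) :
    ⟪f, quad ρ a b c d f⟫ = 2 * ‖f‖ ^ 2 + 2 * (swapCorr ρ f a b c d + swapCorr ρ f a c b d +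
      swapCorr ρ f a d b c) - 2 * (swapCorr ρ f a b b c + swapCorr ρ f a b b d +
      swapCorr ρ f a c c d + swapCorr ρ f b c c d) := by
  have h2 : ∀ z : E, (2 : Module.End ℝ E) z = (2 : ℝ) • z := fun z => by
    rw [← one_add_one_eq_two, two_smul]; rfl
  simp only [quad, threeCycles, LinearMap.sub_apply, LinearMap.add_apply, Module.End.mul_apply,
    h2, inner_sub_right, inner_add_right, inner_smul_right, inner_mul_swap hρ,
    real_inner_self_eq_norm_sq]
  rw [swapCorr_comm b c a b, swapCorr_comm b d a b, swapCorr_comm c d a c, swapCorr_comm c d b c]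
  ring

/-- A correction term depending on three vertices only. -/
noncomputable def tripleTerm (N : ℝ) (a b c : V) : ℝ :=
  if a = b ∧ b = c then N else if a = b ∨ b = c ∨ a = c then -N / 3 else N / 3

/-- Averaging over the three pairings of `a, b, c, d` produces `quadForm` up to terms supported on a
coincidence of two indices and terms depending on three indices only. The values of `tripleTerm`
make the total vanish on every degenerate quadruple; the proof checks each coincidence pattern. -/
theorem symmetrized_swapCorr (hρ : ∀ σ x y, ⟪ρ σ x, ρ σ y⟫ = ⟪x, y⟫) (a b c d : V) :
    (swapCorr ρ f a b c d + swapCorr ρ f a c b d + swapCorr ρ f a d b c) / 3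
      - ((if a = b then ⟪f, ρ (swap c d) f⟫ else 0) + (if c = d then ⟪f, ρ (swap a b) f⟫ else 0)
        + (if a = c then ⟪f, ρ (swap b d) f⟫ else 0) + (if b = d then ⟪f, ρ (swap a c) f⟫ else 0)
        + (if a = d then ⟪f, ρ (swap b c) f⟫ else 0)
        + (if b = c then ⟪f, ρ (swap a d) f⟫ else 0)) / 3
      - (cycleCorr ρ f a b c + cycleCorr ρ f a b d + cycleCorr ρ f a c d + cycleCorr ρ f b c d) / 3
      + (tripleTerm (‖f‖ ^ 2) a b c + tripleTerm (‖f‖ ^ 2) a b d + tripleTerm (‖f‖ ^ 2) a c d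
        + tripleTerm (‖f‖ ^ 2) b c d) / 4 = quadForm ρ f a b c d := by
  have r := fun {a b c : V} => swapCorr_rotate (f := f) hρ (a := a) (b := b) (c := c)
  have cl := swapCorr_comm_left (ρ := ρ) (f := f)
  have cm := swapCorr_comm (ρ := ρ) (f := f)
  have cr := swapCorr_comm_right (ρ := ρ) (f := f)
  have s := swapCorr_self (f := f) hρ
  have s' : ∀ a b, swapCorr ρ f a b b a = ‖f‖ ^ 2 := fun a b => by rw [cr, s]
  have dg := swapCorr_diag (ρ := ρ) (f := f)
  have dg' : ∀ a b c, swapCorr ρ f a b c c = ⟪f, ρ (swap a b) f⟫ := fun a b c => by rw [cm, dg]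
  have dn : ⟪f, ρ (Equiv.refl V) f⟫ = ‖f‖ ^ 2 := by
    rw [← Equiv.Perm.one_def, map_one, Module.End.one_apply, real_inner_self_eq_norm_sq]
  have sc : ∀ x y, ⟪f, ρ (swap x y) f⟫ = ⟪f, ρ (swap y x) f⟫ := fun x y => by
    rw [Equiv.swap_comm]
  rw [quadForm, inner_quad hρ]
  unfold cycleCorr tripleTerm
  rcases eq_or_ne a b with rfl | hab
  · rcases eq_or_ne a c with rfl | hac
    · rcases eq_or_ne a d with rfl | had
      · simp [dg, dn]; ring
      · simp [dg, dg', had]; ring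
    · rcases eq_or_ne a d with rfl | had
      · simp [dg, dg', hac, hac.symm, sc c]; ring
      · rcases eq_or_ne c d with rfl | hcd
        · simp [dg, s, hac, dn]; ring
        · simp [dg, hac, had, hcd]
          obtain ⟨t1, t2, -⟩ := swapCorr_triple (f := f) hρ hac had hcd
          linarith
  · rcases eq_or_ne a c with rfl | hac
    · rcases eq_or_ne a d with rfl | had
      · simp [dg, dg', hab, hab.symm, sc b]; ring
      · rcases eq_or_ne b d with rfl | hbd
        · simp [dg, s, s', hab, hab.symm, dn]; ring
        · simp [dg, hab, hab.symm, had, hbd]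
          obtain ⟨t1, t2, -⟩ := swapCorr_triple (f := f) hρ hab had hbd
          linarith [cr a d b a, cl b a a d, cm a b a d]
    · rcases eq_or_ne a d with rfl | had
      · rcases eq_or_ne b c with rfl | hbc
        · simp [dg, s', hab, hab.symm, dn]; ring
        · simp [dg, hab, hac, hab.symm, hac.symm, hbc]
          obtain ⟨t1, t2, -⟩ := swapCorr_triple (f := f) hρ hab hac hbc
          linarith [cr a b c a, cr a c b a, r hab hac hbc]
      · rcases eq_or_ne b c with rfl | hbc
        · rcases eq_or_ne b d with rfl | hbd
          · simp [dg', hab]; ring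
          · simp [dg', hab, hbd, had]; ring
        · rcases eq_or_ne b d with rfl | hbd
          · simp [dg', hab, hac, hbc, hbc.symm]
            obtain ⟨-, -, t3⟩ := swapCorr_triple (f := f) hρ hab hac hbc
            linarith [cr a b c b, cr a c c b]
          · rcases eq_or_ne c d with rfl | hcd
            · simp [dg', hab, hac, hbc]
              obtain ⟨-, -, t3⟩ := swapCorr_triple (f := f) hρ hab hac hbc
              linarith
            · simp [hab, hac, had, hbc, hbd, hcd]; ring

/-- This and the next two lemmas treat the adjacent transpositions of the four slots, which is
enough to bring the vertex `o` to the first slot. -/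
theorem quadForm_swap_one (hρ : ∀ σ x y, ⟪ρ σ x, ρ σ y⟫ = ⟪x, y⟫) (a b c d : V) :
    quadForm ρ f a b c d = quadForm ρ f b a c d := by
  by_cases h : a ≠ b ∧ a ≠ c ∧ a ≠ d ∧ b ≠ c ∧ b ≠ d ∧ c ≠ d
  · obtain ⟨hab, hac, had, hbc, hbd, hcd⟩ := h
    simp only [quadForm, ne_eq, hab, hac, had, hbc, hbd, hcd, hab.symm, not_false_eq_true, and_self,
      if_true, inner_quad hρ]
    obtain ⟨t1, -, -⟩ := swapCorr_triple (f := f) hρ hab hac hbc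
    obtain ⟨t2, -, -⟩ := swapCorr_triple (f := f) hρ hab had hbd
    linarith [swapCorr_comm_left (ρ := ρ) (f := f) a b c d, swapCorr_comm (ρ := ρ) (f := f) a d b c,
      swapCorr_comm (ρ := ρ) (f := f) b d a c, swapCorr_comm_left (ρ := ρ) (f := f) a b a c,
      swapCorr_comm_left (ρ := ρ) (f := f) a b a d]
  · rw [quadForm, quadForm, if_neg h, if_neg]
    tauto

theorem quadForm_swap_two (hρ : ∀ σ x y, ⟪ρ σ x, ρ σ y⟫ = ⟪x, y⟫) (a b c d : V) :
    quadForm ρ f a b c d = quadForm ρ f a c b d := by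
  by_cases h : a ≠ b ∧ a ≠ c ∧ a ≠ d ∧ b ≠ c ∧ b ≠ d ∧ c ≠ d
  · obtain ⟨hab, hac, had, hbc, hbd, hcd⟩ := h
    simp only [quadForm, ne_eq, hab, hac, had, hbc, hbd, hcd, hbc.symm, not_false_eq_true, and_self,
      if_true, inner_quad hρ]
    obtain ⟨-, -, t1⟩ := swapCorr_triple (f := f) hρ hab hac hbc
    obtain ⟨t2, -, -⟩ := swapCorr_triple (f := f) hρ hbc hbd hcd
    linarith [swapCorr_comm_right (ρ := ρ) (f := f) a d b c,
      swapCorr_comm_right (ρ := ρ) (f := f) a c c b,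
      swapCorr_comm_left (ρ := ρ) (f := f) b c b d]
  · rw [quadForm, quadForm, if_neg h, if_neg]
    tauto

theorem quadForm_swap_three (hρ : ∀ σ x y, ⟪ρ σ x, ρ σ y⟫ = ⟪x, y⟫) (a b c d : V) :
    quadForm ρ f a b c d = quadForm ρ f a b d c := by
  by_cases h : a ≠ b ∧ a ≠ c ∧ a ≠ d ∧ b ≠ c ∧ b ≠ d ∧ c ≠ d
  · obtain ⟨hab, hac, had, hbc, hbd, hcd⟩ := h
    simp only [quadForm, ne_eq, hab, hac, had, hbc, hbd, hcd, hcd.symm, not_false_eq_true, and_self,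
      if_true, inner_quad hρ]
    obtain ⟨-, -, t1⟩ := swapCorr_triple (f := f) hρ hac had hcd
    obtain ⟨-, -, t2⟩ := swapCorr_triple (f := f) hρ hbc hbd hcd
    linarith [swapCorr_comm_right (ρ := ρ) (f := f) a b c d,
      swapCorr_comm_right (ρ := ρ) (f := f) a d d c,
      swapCorr_comm_right (ρ := ρ) (f := f) b d d c]
  · rw [quadForm, quadForm, if_neg h, if_neg]
    tauto

theorem quadForm_nonneg (hρ : ∀ σ x y, ⟪ρ σ x, ρ σ y⟫ = ⟪x, y⟫) (a b c d : V) :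
    0 ≤ quadForm ρ f a b c d := by
  unfold quadForm
  split_ifs with h
  · obtain ⟨hab, hac, had, hbc, hbd, hcd⟩ := h
    have := inner_quad_nonneg hρ hab hac had hbc hbd hcd f
    positivity
  · rfl

theorem quadForm_le (hρ : ∀ σ x y, ⟪ρ σ x, ρ σ y⟫ = ⟪x, y⟫) {o a b c d : V}
    (hoa : o ≠ a) (hob : o ≠ b) (hoc : o ≠ c) (hod : o ≠ d) :
    quadForm ρ f a b c d ≤ quadForm ρ f o b c d + quadForm ρ f o a c d + quadForm ρ f o a b d +
      quadForm ρ f o a b c := by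
  by_cases h : a ≠ b ∧ a ≠ c ∧ a ≠ d ∧ b ≠ c ∧ b ≠ d ∧ c ≠ d
  · obtain ⟨hab, hac, had, hbc, hbd, hcd⟩ := h
    simp only [quadForm, ne_eq, hab, hac, had, hbc, hbd, hcd, hoa, hob, hoc, hod,
      not_false_eq_true, and_self, if_true]
    linarith [inner_quad_le hρ hoa hob hoc hod hab hac had hbc hbd hcd f]
  · rw [quadForm, if_neg h]
    have := quadForm_nonneg (f := f) hρ o
    linarith [this b c d, this a c d, this a b d, this a b c]

end Octopus

/-! ### Quadruple sums with product weights. -/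

section QuadSum

variable {V : Type*} [Fintype V] {c : V → ℝ}

/-- The sum of `F` over all quadruples of vertices, weighted by the product of the weights. -/
def quadSum (c : V → ℝ) (F : V → V → V → V → ℝ) : ℝ :=
  ∑ x, ∑ y, ∑ z, ∑ w, c x * c y * c z * c w * F x y z w

theorem quadSum_add (F G : V → V → V → V → ℝ) :
    quadSum c (fun x y z w => F x y z w + G x y z w) = quadSum c F + quadSum c G := by
  simp only [quadSum, mul_add, Finset.sum_add_distrib]

theorem quadSum_sub (F G : V → V → V → V → ℝ) :
    quadSum c (fun x y z w => F x y z w - G x y z w) = quadSum c F - quadSum c G := by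
  simp only [quadSum, mul_sub, Finset.sum_sub_distrib]

theorem quadSum_div (F : V → V → V → V → ℝ) (r : ℝ) :
    quadSum c (fun x y z w => F x y z w / r) = quadSum c F / r := by
  simp only [quadSum, mul_div_assoc', Finset.sum_div]

theorem quadSum_swap_one (F : V → V → V → V → ℝ) :
    quadSum c (fun x y z w => F y x z w) = quadSum c F := by
  rw [quadSum, Finset.sum_comm]
  refine Finset.sum_congr rfl fun x _ => Finset.sum_congr rfl fun y _ =>
    Finset.sum_congr rfl fun z _ => Finset.sum_congr rfl fun w _ => ?_
  ring

theorem quadSum_swap_two (F : V → V → V → V → ℝ) :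
    quadSum c (fun x y z w => F x z y w) = quadSum c F := by
  refine Finset.sum_congr rfl fun x _ => ?_
  rw [Finset.sum_comm]
  refine Finset.sum_congr rfl fun y _ =>
    Finset.sum_congr rfl fun z _ => Finset.sum_congr rfl fun w _ => ?_
  ring

theorem quadSum_swap_three (F : V → V → V → V → ℝ) :
    quadSum c (fun x y z w => F x y w z) = quadSum c F := by
  refine Finset.sum_congr rfl fun x _ => Finset.sum_congr rfl fun y _ => ?_
  rw [Finset.sum_comm]
  refine Finset.sum_congr rfl fun z _ => Finset.sum_congr rfl fun w _ => ?_
  ring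

/-- The absent variable can be summed alone, giving the factor `∑ c = 0`. This is what makes
three-variable corrections free. -/
theorem quadSum_eq_zero (hc : ∑ x, c x = 0) (F : V → V → V → ℝ) :
    quadSum c (fun x y z _ => F x y z) = 0 ∧ quadSum c (fun x y _ w => F x y w) = 0 ∧
    quadSum c (fun x _ z w => F x z w) = 0 ∧ quadSum c (fun _ y z w => F y z w) = 0 := by
  have h1 : quadSum c (fun x y z _ => F x y z) = 0 := by
    refine Finset.sum_eq_zero fun x _ => Finset.sum_eq_zero fun y _ =>
      Finset.sum_eq_zero fun z _ => ?_
    rw [← Finset.sum_mul, ← Finset.mul_sum, hc, mul_zero, zero_mul]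
  have h2 := quadSum_swap_three (c := c) (fun x y z _ => F x y z)
  have h3 := quadSum_swap_two (c := c) (fun x y _ w => F x y w)
  have h4 := quadSum_swap_one (c := c) (fun x _ z w => F x z w)
  exact ⟨h1, h2.trans h1, h3.trans (h2.trans h1), h4.trans (h3.trans (h2.trans h1))⟩

end QuadSum

/-! ### The octopus inequality. -/

section OctopusInequality

variable {V E : Type*} [Fintype V] [DecidableEq V] [NormedAddCommGroup E] [InnerProductSpace ℝ E]
  {ρ : Perm V →* Module.End ℝ E}

/-- In the symmetrized identity the three pairings have equal sums and the three-variable terms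
vanish. Each of the six diagonal terms, weighted by `1/3`, contributes `(∑ c²) ⟪f, D f⟫`, hence the
factor `2`. -/
theorem quadSum_swapCorr (hρ : ∀ σ x y, ⟪ρ σ x, ρ σ y⟫ = ⟪x, y⟫) {c : V → ℝ}
    (hc : ∑ x, c x = 0) (f : E) :
    quadSum c (swapCorr ρ f) = 2 * (∑ x, c x ^ 2) * (∑ x, ∑ y, c x * c y * ⟪f, ρ (swap x y) f⟫) +
      quadSum c (quadForm ρ f) := by
  have hK1 := quadSum_swap_two (c := c) (swapCorr ρ f)
  have hK2 := quadSum_swap_three (c := c) (fun x y z w => swapCorr ρ f x z y w)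
  set δ : V → V → V → V → ℝ := fun x y z w => if x = y then ⟪f, ρ (swap z w) f⟫ else 0 with hδ
  have d1 := quadSum_swap_two (c := c) δ
  have d2 := quadSum_swap_three (c := c) (fun x y z w => δ x z y w)
  have d3 := quadSum_swap_one (c := c) (fun x y z w => δ x z y w)
  have d4 := quadSum_swap_three (c := c) (fun x y z w => δ y z x w)
  have d5 := quadSum_swap_two (c := c) (fun x y z w => δ y w x z)
  obtain ⟨t1, t2, t3, t4⟩ := quadSum_eq_zero hc (cycleCorr ρ f)
  obtain ⟨g1, g2, g3, g4⟩ := quadSum_eq_zero hc (tripleTerm (V := V) (‖f‖ ^ 2))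
  have hδs : quadSum c δ = (∑ x, c x ^ 2) * (∑ x, ∑ y, c x * c y * ⟪f, ρ (swap x y) f⟫) := by
    rw [quadSum, Finset.sum_mul]
    refine Finset.sum_congr rfl fun x _ => ?_
    rw [Finset.sum_eq_single x]
    · simp only [hδ, if_true, Finset.mul_sum]
      refine Finset.sum_congr rfl fun z _ => Finset.sum_congr rfl fun w _ => ?_
      ring
    · intro y _ hy
      simp [hδ, hy.symm]
    · simp
  have key : quadSum c (quadForm ρ f) = quadSum c (fun x y z w =>
      (swapCorr ρ f x y z w + swapCorr ρ f x z y w + swapCorr ρ f x w y z) / 3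
      - (δ x y z w + δ z w x y + δ x z y w + δ y w x z + δ x w y z + δ y z x w) / 3
      - (cycleCorr ρ f x y z + cycleCorr ρ f x y w + cycleCorr ρ f x z w + cycleCorr ρ f y z w) / 3
      + (tripleTerm (‖f‖ ^ 2) x y z + tripleTerm (‖f‖ ^ 2) x y w + tripleTerm (‖f‖ ^ 2) x z w
        + tripleTerm (‖f‖ ^ 2) y z w) / 4) := congrArg (quadSum c) <| by
    funext x y z w
    exact (symmetrized_swapCorr hρ x y z w).symm
  simp only [quadSum_add, quadSum_sub, quadSum_div, t1, t2, t3, t4, g1, g2, g3, g4] at key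
  have hK0 : quadSum c (fun x y z w => swapCorr ρ f x y z w) = quadSum c (swapCorr ρ f) := rfl
  have hd0 : quadSum c (fun x y z w => δ x y z w) = quadSum c δ := rfl
  linarith

/-- The octopus inequality for orthogonal representations of the symmetric group. -/
theorem octopus (hρ : ∀ σ x y, ⟪ρ σ x, ρ σ y⟫ = ⟪x, y⟫) {c : V → ℝ} (hc : ∑ x, c x = 0) (o : V)
    (hpos : ∀ x, x ≠ o → 0 ≤ c x) (f : E) :
    0 ≤ ∑ x, ∑ y, c x * c y * ⟪f, ρ (swap x y) f⟫ := by
  have hle : quadSum c (quadForm ρ f) ≤ 0 := by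
    -- Subtracting three-variable terms does not change the sum, but makes the summand zero as soon
    -- as an index is `o`, the only vertex whose weight may be negative. Elsewhere `quadForm_le`
    -- applies.
    have e : quadSum c (quadForm ρ f) = quadSum c (fun x y z w => quadForm ρ f x y z w -
        quadForm ρ f o y z w - quadForm ρ f o x z w - quadForm ρ f o x y w -
        quadForm ρ f o x y z) := by
      obtain ⟨t1, t2, t3, t4⟩ := quadSum_eq_zero hc (quadForm ρ f o)
      simp only [quadSum_sub, t1, t2, t3, t4, sub_zero]
    have z1 : ∀ x y, quadForm ρ f o o x y = 0 := fun x y => by simp [quadForm]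
    have z2 : ∀ x y, quadForm ρ f o x o y = 0 := fun x y => by simp [quadForm]
    have z3 : ∀ x y, quadForm ρ f o x y o = 0 := fun x y => by simp [quadForm]
    have w2 : ∀ x y z, quadForm ρ f x o y z = quadForm ρ f o x y z :=
      fun x y z => quadForm_swap_one hρ _ _ _ _
    have w3 : ∀ x y z, quadForm ρ f x y o z = quadForm ρ f o x y z :=
      fun x y z => by rw [quadForm_swap_two hρ, w2]
    have w4 : ∀ x y z, quadForm ρ f x y z o = quadForm ρ f o x y z := by
      intro x y z
      rw [quadForm_swap_three hρ, w3]
    rw [e]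
    refine Finset.sum_nonpos fun x _ => Finset.sum_nonpos fun y _ => Finset.sum_nonpos fun z _ =>
      Finset.sum_nonpos fun w _ => ?_
    rcases eq_or_ne x o with rfl | hx
    · simp [z1]
    rcases eq_or_ne y o with rfl | hy
    · simp [z1, z2, w2]
    rcases eq_or_ne z o with rfl | hz
    · simp [z2, z3, w3]
    rcases eq_or_ne w o with rfl | hw
    · simp [z3, w4]
    have hw' := mul_nonneg (mul_nonneg (mul_nonneg (hpos x hx) (hpos y hy)) (hpos z hz)) (hpos w hw)
    refine mul_nonpos_of_nonneg_of_nonpos hw' ?_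
    linarith [quadForm_le (f := f) hρ hx.symm hy.symm hz.symm hw.symm]
  have hD : 0 ≤ quadSum c (swapCorr ρ f) := by
    have : quadSum c (swapCorr ρ f) = ‖∑ x, ∑ y, (c x * c y) • ρ (swap x y) f‖ ^ 2 := by
      rw [← real_inner_self_eq_norm_sq]
      simp only [sum_inner, inner_sum, inner_smul_left, inner_smul_right, quadSum, swapCorr,
        Finset.mul_sum]
      refine Finset.sum_congr rfl fun x _ => Finset.sum_congr rfl fun y _ =>
        Finset.sum_congr rfl fun z _ => Finset.sum_congr rfl fun w _ => ?_
      rw [RCLike.conj_to_real, real_inner_comm]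
      ring
    rw [this]
    positivity
  rw [quadSum_swapCorr hρ hc] at hD
  have hσ : 0 ≤ ∑ x, c x ^ 2 := Finset.sum_nonneg fun x _ => sq_nonneg _
  -- Dividing by `∑ c²` needs it positive; otherwise `c = 0`.
  rcases hσ.eq_or_lt with h0 | h0
  · have hz : ∀ x, c x = 0 := fun x => by
      have := (Finset.sum_eq_zero_iff_of_nonneg fun x _ => sq_nonneg (c x)).1 h0.symm x
      simpa using this
    simp [hz]
  · by_contra hneg
    push Not at hneg
    nlinarith [mul_neg_of_pos_of_neg h0 hneg]

end OctopusInequality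

/-! ### The octopus inequality as a comparison of energies. -/

section Configurations

variable {V : Type*} [Fintype V] [DecidableEq V]

/-- The permutation representation on the functions of the particle configurations `V → Bool`. -/
def configRep (V : Type*) [Fintype V] [DecidableEq V] :
    Perm V →* Module.End ℝ (EuclideanSpace ℝ (V → Bool)) where
  toFun σ :=
    { toFun := fun f => WithLp.toLp 2 fun ζ => f (ζ ∘ σ)
      map_add' := fun _ _ => rfl
      map_smul' := fun _ _ => rfl }
  map_one' := rfl
  map_mul' _ _ := rfl

theorem sum_comp_perm (σ : Perm V) (F : (V → Bool) → ℝ) : ∑ ζ, F (ζ ∘ σ) = ∑ ζ, F ζ :=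
  (Equiv.arrowCongr σ.symm (Equiv.refl Bool)).sum_comp F

theorem inner_configRep (σ : Perm V) (f g : EuclideanSpace ℝ (V → Bool)) :
    ⟪configRep V σ f, configRep V σ g⟫ = ⟪f, g⟫ := by
  simp only [PiLp.inner_apply]
  exact sum_comp_perm σ fun ζ => inner ℝ (f ζ) (g ζ)

/-- Twice the contribution of the pair `x, y` to the Dirichlet form. -/
def swapEnergy (f : (V → Bool) → ℝ) (x y : V) : ℝ :=
  ∑ ζ : V → Bool, (f (ζ ∘ swap x y) - f ζ) ^ 2

theorem swapEnergy_nonneg (f : (V → Bool) → ℝ) (x y : V) : 0 ≤ swapEnergy f x y :=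
  Finset.sum_nonneg fun _ _ => sq_nonneg _

theorem swapEnergy_comm (f : (V → Bool) → ℝ) (x y : V) :
    swapEnergy f x y = swapEnergy f y x := by
  rw [swapEnergy, Equiv.swap_comm, swapEnergy]

theorem swapEnergy_self (f : (V → Bool) → ℝ) (x : V) : swapEnergy f x x = 0 := by
  simp [swapEnergy]

theorem swapEnergy_eq (f : (V → Bool) → ℝ) (x y : V) :
    swapEnergy f x y = 2 * ∑ ζ, f ζ * (f ζ - f (ζ ∘ swap x y)) := by
  have h := sum_comp_perm (swap x y) fun ζ => f ζ ^ 2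
  have e : swapEnergy f x y = ∑ ζ, (f (ζ ∘ swap x y)) ^ 2 - ∑ ζ, f ζ ^ 2 +
      2 * ∑ ζ, f ζ * (f ζ - f (ζ ∘ swap x y)) := by
    rw [swapEnergy, Finset.mul_sum, ← Finset.sum_sub_distrib, ← Finset.sum_add_distrib]
    exact Finset.sum_congr rfl fun ζ _ => by ring
  rw [e, h, sub_self, zero_add]

theorem sum_swapEnergy_le_zero {c : V → ℝ} (hc : ∑ x, c x = 0) (o : V)
    (hpos : ∀ x, x ≠ o → 0 ≤ c x) (f : (V → Bool) → ℝ) :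
    ∑ x, ∑ y, c x * c y * swapEnergy f x y ≤ 0 := by
  have h := octopus (ρ := configRep V) inner_configRep hc o hpos (WithLp.toLp 2 f)
  -- The term `‖f‖²` does not depend on `x, y`, so it drops out by `∑ c = 0` and the inequality
  -- changes sign.
  have e : ∀ x y, ⟪WithLp.toLp 2 f, configRep V (swap x y) (WithLp.toLp 2 f)⟫ =
      ∑ ζ, f ζ ^ 2 - swapEnergy f x y / 2 := by
    intro x y
    rw [swapEnergy_eq, mul_div_cancel_left₀ _ two_ne_zero, ← Finset.sum_sub_distrib,
      PiLp.inner_apply]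
    refine Finset.sum_congr rfl fun ζ _ => ?_
    change f (ζ ∘ swap x y) * f ζ = _
    ring
  have e2 : ∑ x, ∑ y, c x * c y * ⟪WithLp.toLp 2 f, configRep V (swap x y) (WithLp.toLp 2 f)⟫ =
      (∑ x, c x) * (∑ y, c y) * ∑ ζ, f ζ ^ 2 - (∑ x, ∑ y, c x * c y * swapEnergy f x y) / 2 := by
    rw [Finset.sum_mul_sum, Finset.sum_mul, Finset.sum_div, ← Finset.sum_sub_distrib]
    refine Finset.sum_congr rfl fun x _ => ?_
    rw [Finset.sum_mul, Finset.sum_div, ← Finset.sum_sub_distrib]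
    refine Finset.sum_congr rfl fun y _ => ?_
    rw [e]
    ring
  rw [e2, hc] at h
  linarith

end Configurations

/-- The octopus inequality, with the centre of the star at the vertex `0`. -/
theorem octopus_fin {n : ℕ} {w : Fin n → ℝ} (hw : ∀ i, 0 ≤ w i) (f : (Fin (n + 1) → Bool) → ℝ) :
    ∑ i, ∑ j, w i * w j / (∑ l, w l) * swapEnergy f i.succ j.succ ≤
      2 * ∑ i, w i * swapEnergy f 0 i.succ := by
  have hC : 0 ≤ ∑ l, w l := Finset.sum_nonneg fun i _ => hw i
  -- The centre gets the negative weight that makes the total zero.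
  have h := sum_swapEnergy_le_zero (c := Fin.cons (-∑ l, w l) w) (by simp [Fin.sum_univ_succ]) 0
    (by
      intro x hx
      obtain ⟨i, rfl⟩ := Fin.exists_succ_eq.2 hx
      simpa using hw i) f
  simp only [Fin.sum_univ_succ (n := n), Fin.cons_zero, Fin.cons_succ, swapEnergy_self,
    Finset.sum_add_distrib, swapEnergy_comm f _ 0] at h
  set C := ∑ l, w l
  have e1 : ∑ i, -C * w i * swapEnergy f 0 i.succ = -C * ∑ i, w i * swapEnergy f 0 i.succ := by
    rw [Finset.mul_sum]; exact Finset.sum_congr rfl fun i _ => by ring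
  have e2 : ∑ i, w i * -C * swapEnergy f 0 i.succ = -C * ∑ i, w i * swapEnergy f 0 i.succ := by
    rw [Finset.mul_sum]; exact Finset.sum_congr rfl fun i _ => by ring
  have e3 : ∑ i, ∑ j, w i * w j / C * swapEnergy f i.succ j.succ =
      (∑ i, ∑ j, w i * w j * swapEnergy f i.succ j.succ) / C := by
    simp only [Finset.sum_div]
    exact Finset.sum_congr rfl fun i _ => Finset.sum_congr rfl fun j _ => by ring
  rw [e1, e2] at h
  rw [e3]
  rcases hC.eq_or_lt with h0 | h0
  · rw [← h0, div_zero]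
    exact mul_nonneg zero_le_two (Finset.sum_nonneg fun i _ =>
      mul_nonneg (hw i) (swapEnergy_nonneg _ _ _))
  · rw [div_le_iff₀ h0]
    linarith

/-- A lower bound for the quadratic form of a symmetric operator on an invariant subspace may be
checked on the eigenvectors. -/
theorem le_inner_of_forall_eigenvector {E : Type*} [NormedAddCommGroup E] [InnerProductSpace ℝ E]
    [FiniteDimensional ℝ E] {T : E →ₗ[ℝ] E} (hT : T.IsSymmetric) {M : Submodule ℝ E}
    (hM : ∀ x ∈ M, T x ∈ M) {r : ℝ}
    (h : ∀ g ∈ M, ∀ μ : ℝ, T g = μ • g → r * ‖g‖ ^ 2 ≤ ⟪g, T g⟫) {f : E} (hf : f ∈ M) :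
    r * ‖f‖ ^ 2 ≤ ⟪f, T f⟫ := by
  have hS := hT.restrict_invariant hM
  set S := T.restrict hM
  set b := hS.eigenvectorBasis rfl
  set ev := hS.eigenvalues rfl
  have hb : ∀ i, S (b i) = ev i • b i := fun i => hS.apply_eigenvectorBasis rfl i
  have hev : ∀ i, r ≤ ev i := by
    intro i
    have hbi : ‖(b i : E)‖ = 1 := b.orthonormal.1 i
    have h1 : T (b i : E) = ev i • (b i : E) := congrArg Subtype.val (hb i)
    have h2 := h (b i) (b i).2 (ev i) h1
    rw [h1, inner_smul_right, real_inner_self_eq_norm_sq, hbi] at h2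
    simpa using h2
  let f' : M := ⟨f, hf⟩
  have e1 : ‖f‖ ^ 2 = ∑ i, ⟪f', b i⟫ * ⟪b i, f'⟫ := by
    rw [b.sum_inner_mul_inner, real_inner_self_eq_norm_sq]; rfl
  have e2 : ⟪f, T f⟫ = ∑ i, ev i * (⟪f', b i⟫ * ⟪b i, f'⟫) := by
    have : ⟪f, T f⟫ = ⟪f', S f'⟫ := rfl
    rw [this, ← b.sum_inner_mul_inner]
    refine Finset.sum_congr rfl fun i _ => ?_
    rw [← hS, hb, inner_smul_left, RCLike.conj_to_real]
    ring
  rw [e1, e2, Finset.mul_sum]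
  refine Finset.sum_le_sum fun i _ => mul_le_mul_of_nonneg_right (hev i) ?_
  rw [real_inner_comm]
  exact mul_self_nonneg _

/-! ### Dirichlet forms, and the projection of exclusion onto the walk. -/

section Dirichlet

variable {V : Type*} [Fintype V]

/-- The number of particles of a configuration. -/
def particleNumber (ζ : V → Bool) : ℕ := ∑ x, (ζ x).toNat

theorem particleNumber_comp (σ : Perm V) (ζ : V → Bool) :
    particleNumber (ζ ∘ σ) = particleNumber ζ :=
  Equiv.sum_comp σ fun x => (ζ x).toNat

/-- The Dirichlet form of the random walk with conductances `c`. -/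
noncomputable def walkEnergy (c : V → V → ℝ) (φ : V → ℝ) : ℝ :=
  (∑ x, ∑ y, c x y * (φ y - φ x) ^ 2) / 2

/-- The Poincaré inequality with constant `r` for the random walk. -/
def WalkPoincare (c : V → V → ℝ) (r : ℝ) : Prop :=
  ∀ φ : V → ℝ, ∑ x, φ x = 0 → r * ∑ x, φ x ^ 2 ≤ walkEnergy c φ

theorem walkEnergy_eq {c : V → V → ℝ} (hsymm : ∀ x y, c x y = c y x) (φ : V → ℝ) :
    walkEnergy c φ = ∑ x, φ x * ∑ y, c x y * (φ x - φ y) := by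
  have h : ∑ x, φ x * ∑ y, c x y * (φ x - φ y) = ∑ x, ∑ y, c x y * (φ y * (φ y - φ x)) := by
    rw [Finset.sum_comm]
    simp only [Finset.mul_sum]
    refine Finset.sum_congr rfl fun x _ => Finset.sum_congr rfl fun y _ => ?_
    rw [hsymm x y]
    ring
  have h2 : walkEnergy c φ * 2 = ∑ x, φ x * ∑ y, c x y * (φ x - φ y) +
      ∑ x, φ x * ∑ y, c x y * (φ x - φ y) := by
    nth_rw 1 [h]
    rw [walkEnergy, div_mul_cancel₀ _ two_ne_zero, ← Finset.sum_add_distrib]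
    refine Finset.sum_congr rfl fun x _ => ?_
    rw [Finset.mul_sum, ← Finset.sum_add_distrib]
    exact Finset.sum_congr rfl fun y _ => by ring
  linarith

variable [DecidableEq V]

/-- The Dirichlet form of the exclusion process with conductances `c`. -/
noncomputable def exclusionEnergy (c : V → V → ℝ) (f : (V → Bool) → ℝ) : ℝ :=
  (∑ x, ∑ y, c x y * swapEnergy f x y) / 4

/-- The Poincaré inequality with constant `r` for the exclusion processes with any number of
particles. -/
def ExclusionPoincare (c : V → V → ℝ) (r : ℝ) : Prop :=
  ∀ f : (V → Bool) → ℝ, (∀ k, ∑ ζ, (if particleNumber ζ = k then f ζ else 0) = 0) →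
    r * ∑ ζ, f ζ ^ 2 ≤ exclusionEnergy c f

theorem exclusionEnergy_nonneg {c : V → V → ℝ} (hc : ∀ x y, 0 ≤ c x y) (f : (V → Bool) → ℝ) :
    0 ≤ exclusionEnergy c f :=
  div_nonneg (Finset.sum_nonneg fun x _ => Finset.sum_nonneg fun y _ =>
    mul_nonneg (hc x y) (swapEnergy_nonneg f x y)) (by norm_num)

/-- The negative generator of the exclusion process on all configurations. -/
noncomputable def exclusionOperator (c : V → V → ℝ) :
    EuclideanSpace ℝ (V → Bool) →ₗ[ℝ] EuclideanSpace ℝ (V → Bool) where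
  toFun f := WithLp.toLp 2 fun ζ => (∑ x, ∑ y, c x y * (f ζ - f (ζ ∘ swap x y))) / 2
  map_add' f g := by
    ext ζ
    simp only [PiLp.add_apply, ← add_div, ← Finset.sum_add_distrib]
    congr 1
    exact Finset.sum_congr rfl fun x _ => Finset.sum_congr rfl fun y _ => by ring
  map_smul' r f := by
    ext ζ
    simp only [PiLp.smul_apply, smul_eq_mul, RingHom.id_apply, mul_div_assoc', Finset.mul_sum]
    congr 1
    exact Finset.sum_congr rfl fun x _ => Finset.sum_congr rfl fun y _ => by ring

theorem exclusionOperator_apply (c : V → V → ℝ) (f : EuclideanSpace ℝ (V → Bool)) (ζ : V → Bool) :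
    exclusionOperator c f ζ = (∑ x, ∑ y, c x y * (f ζ - f (ζ ∘ swap x y))) / 2 := rfl

/-- Reindexing by the swap moves the operator onto the test function `u`. Indicators as `u` give
both the conservation of sector sums and the one-site equation. -/
theorem sum_mul_exclusionOperator (c : V → V → ℝ) (f : EuclideanSpace ℝ (V → Bool))
    (u : (V → Bool) → ℝ) :
    ∑ ζ, u ζ * exclusionOperator c f ζ =
      (∑ x, ∑ y, c x y * ∑ ζ, (u ζ - u (ζ ∘ swap x y)) * f ζ) / 2 := by
  have h : ∀ x y, ∑ ζ, (u ζ - u (ζ ∘ swap x y)) * f ζ =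
      ∑ ζ, u ζ * (f ζ - f (ζ ∘ swap x y)) := by
    intro x y
    have := sum_comp_perm (swap x y) fun ζ => u ζ * f (ζ ∘ swap x y)
    have e : ∀ ζ : V → Bool, (ζ ∘ swap x y) ∘ swap x y = ζ := fun ζ => by
      funext t; simp
    simp only [e] at this
    simp only [sub_mul, mul_sub, Finset.sum_sub_distrib, this]
  simp only [h, exclusionOperator_apply, Finset.mul_sum, mul_div_assoc', Finset.sum_div]
  rw [Finset.sum_comm]
  refine Finset.sum_congr rfl fun x _ => ?_
  rw [Finset.sum_comm]
  refine Finset.sum_congr rfl fun y _ => Finset.sum_congr rfl fun ζ _ => ?_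
  ring

theorem exclusionOperator_isSymmetric (c : V → V → ℝ) : (exclusionOperator c).IsSymmetric := by
  intro f g
  rw [PiLp.inner_apply, PiLp.inner_apply]
  change ∑ ζ, g ζ * exclusionOperator c f ζ = ∑ ζ, exclusionOperator c g ζ * f ζ
  rw [sum_mul_exclusionOperator]
  simp only [exclusionOperator_apply, div_mul_eq_mul_div, Finset.sum_mul, Finset.mul_sum,
    Finset.sum_div]
  symm
  rw [Finset.sum_comm]
  refine Finset.sum_congr rfl fun x _ => ?_
  rw [Finset.sum_comm]
  refine Finset.sum_congr rfl fun y _ => Finset.sum_congr rfl fun ζ _ => ?_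
  ring

theorem inner_exclusionOperator (c : V → V → ℝ) (f : EuclideanSpace ℝ (V → Bool)) :
    ⟪f, exclusionOperator c f⟫ = exclusionEnergy c f := by
  rw [real_inner_comm, PiLp.inner_apply]
  change ∑ ζ, f ζ * exclusionOperator c f ζ = _
  rw [exclusionEnergy]
  simp only [swapEnergy_eq, exclusionOperator_apply, mul_div_assoc', Finset.mul_sum,
    Finset.sum_div]
  rw [Finset.sum_comm]
  refine Finset.sum_congr rfl fun x _ => ?_
  rw [Finset.sum_comm]
  refine Finset.sum_congr rfl fun y _ => Finset.sum_congr rfl fun ζ _ => ?_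
  ring

/-- The functions with zero sum over the configurations with a given number of particles. -/
def sumZero (V : Type*) [Fintype V] [DecidableEq V] :
    Submodule ℝ (EuclideanSpace ℝ (V → Bool)) where
  carrier := {f | ∀ k, ∑ ζ, (if particleNumber ζ = k then f ζ else 0) = 0}
  zero_mem' k := by simp
  add_mem' {f g} hf hg k := by
    have h : ∑ ζ, (if particleNumber ζ = k then (f + g) ζ else 0) =
        ∑ ζ, (if particleNumber ζ = k then f ζ else 0) +
        ∑ ζ, (if particleNumber ζ = k then g ζ else 0) := by
      rw [← Finset.sum_add_distrib]
      exact Finset.sum_congr rfl fun ζ _ => by split_ifs <;> simp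
    rw [h, hf k, hg k, add_zero]
  smul_mem' r f hf k := by
    have h : ∑ ζ, (if particleNumber ζ = k then (r • f) ζ else 0) =
        r * ∑ ζ, (if particleNumber ζ = k then f ζ else 0) := by
      rw [Finset.mul_sum]
      exact Finset.sum_congr rfl fun ζ _ => by split_ifs <;> simp
    rw [h, hf k, mul_zero]

theorem exclusionOperator_mem (c : V → V → ℝ) (f : EuclideanSpace ℝ (V → Bool)) :
    exclusionOperator c f ∈ sumZero V := by
  intro k
  have h := sum_mul_exclusionOperator c f fun ζ => if particleNumber ζ = k then 1 else 0
  simp only [particleNumber_comp, sub_self, zero_mul, Finset.sum_const_zero, mul_zero, zero_div,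
    ite_mul, one_mul] at h
  exact h

/-- Only swaps with `x` as an endpoint contribute; each is met as `(x, y)` and as `(y, x)`, which
the division by `2` undoes. -/
theorem sum_sub_swap {c : V → V → ℝ} (hsymm : ∀ x y, c x y = c y x) (φ : V → ℝ) (x : V) :
    (∑ a, ∑ b, c a b * (φ x - φ (swap a b x))) / 2 = ∑ y, c x y * (φ x - φ y) := by
  have e : ∀ a b, c a b * (φ x - φ (swap a b x)) =
      (if a = x then c a b * (φ x - φ b) else 0) +
      (if b = x then c a b * (φ x - φ a) else 0) := by
    intro a b
    rcases eq_or_ne a x with rfl | ha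
    · rcases eq_or_ne b a with rfl | hb
      · simp
      · simp [hb]
    · rcases eq_or_ne b x with rfl | hb
      · simp [ha]
      · simp [ha, hb, Equiv.swap_apply_of_ne_of_ne ha.symm hb.symm]
  simp only [e, Finset.sum_add_distrib]
  rw [Finset.sum_comm]
  simp only [Finset.sum_ite_eq', Finset.mem_univ, if_true, hsymm _ x]
  ring

/-- The sum of `f` over the configurations with `k` particles one of which is at `x`. -/
def occupiedSum (f : (V → Bool) → ℝ) (k : ℕ) (x : V) : ℝ :=
  ∑ ζ, if particleNumber ζ = k ∧ ζ x = true then f ζ else 0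

/-- The indicator of a particle at `x`, composed with a swap, is the indicator of a particle at the
image of `x`; the one-site sums thus satisfy a closed equation, that of a single walker. -/
theorem occupiedSum_exclusionOperator {c : V → V → ℝ} (hsymm : ∀ x y, c x y = c y x)
    (f : EuclideanSpace ℝ (V → Bool)) (k : ℕ) (x : V) :
    occupiedSum (exclusionOperator c f) k x =
      ∑ y, c x y * (occupiedSum f k x - occupiedSum f k y) := by
  have h := sum_mul_exclusionOperator c f fun ζ => if particleNumber ζ = k ∧ ζ x = true then 1 else 0
  simp only [particleNumber_comp, ite_mul, one_mul, zero_mul, sub_mul, Finset.sum_sub_distrib,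
    Function.comp_apply] at h
  change occupiedSum (exclusionOperator c f) k x = (∑ a, ∑ b, c a b * (occupiedSum f k x -
    occupiedSum f k (swap a b x))) / 2 at h
  rw [h, sum_sub_swap hsymm]

theorem sum_occupiedSum (f : (V → Bool) → ℝ) (k : ℕ) :
    ∑ x, occupiedSum f k x = k * ∑ ζ, (if particleNumber ζ = k then f ζ else 0) := by
  unfold occupiedSum
  rw [Finset.sum_comm, Finset.mul_sum]
  refine Finset.sum_congr rfl fun ζ _ => ?_
  split_ifs with h
  · simp only [h, true_and]
    rw [← h, particleNumber, Nat.cast_sum, Finset.sum_mul]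
    refine Finset.sum_congr rfl fun x _ => ?_
    cases ζ x <;> simp
  · simp [h]

theorem exclusionEnergy_eigenvector {c : V → V → ℝ} (hsymm : ∀ x y, c x y = c y x) {r : ℝ}
    (hr : WalkPoincare c r) {g : EuclideanSpace ℝ (V → Bool)} (hg : g ∈ sumZero V) {μ : ℝ}
    (hμ : exclusionOperator c g = μ • g) {k : ℕ} {x : V} (hx : occupiedSum g k x ≠ 0) :
    r ≤ μ := by
  set φ := occupiedSum g k
  have hφ : ∑ x, φ x = 0 := by rw [sum_occupiedSum, hg k, mul_zero]
  have hL : ∀ x, ∑ y, c x y * (φ x - φ y) = μ * φ x := by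
    intro x
    rw [← occupiedSum_exclusionOperator hsymm g k x, hμ]
    simp only [φ, occupiedSum, Finset.mul_sum]
    exact Finset.sum_congr rfl fun ζ _ => by split_ifs <;> simp
  have h := hr φ hφ
  rw [walkEnergy_eq hsymm] at h
  simp only [hL] at h
  have e : ∑ x, φ x * (μ * φ x) = μ * ∑ x, φ x ^ 2 := by
    rw [Finset.mul_sum]
    exact Finset.sum_congr rfl fun x _ => by ring
  rw [e] at h
  have hpos : 0 < ∑ x, φ x ^ 2 :=
    Finset.sum_pos' (fun x _ => sq_nonneg _) ⟨x, Finset.mem_univ x, by positivity⟩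
  exact le_of_mul_le_mul_right h hpos

end Dirichlet

/-! ### Elimination of the vertex `0`. -/

section Reduction

variable {n : ℕ}

/-- The conductances of the network obtained by removing the vertex `0`. -/
noncomputable def reducedConductance (c : Fin (n + 1) → Fin (n + 1) → ℝ) (i j : Fin n) : ℝ :=
  c i.succ j.succ + c 0 i.succ * c 0 j.succ / ∑ l : Fin n, c 0 l.succ

/-- The variance is half the mean squared difference of two independent copies. If the total weight
is `0`, all weights are, and both sides vanish. -/
theorem sum_sq_sub_weighted_mean {w : Fin n → ℝ} (hw : ∀ i, 0 ≤ w i) (ψ : Fin n → ℝ) :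
    ∑ i, w i * (ψ i - (∑ l, w l * ψ l) / ∑ l, w l) ^ 2 =
      (∑ i, ∑ j, w i * w j / (∑ l, w l) * (ψ j - ψ i) ^ 2) / 2 := by
  rcases (Finset.sum_nonneg fun i _ => hw i : 0 ≤ ∑ l, w l).eq_or_lt with h0 | h0
  · have hz : ∀ i, w i = 0 := fun i =>
      (Finset.sum_eq_zero_iff_of_nonneg fun i _ => hw i).1 h0.symm i (Finset.mem_univ i)
    simp [hz]
  · set C := ∑ l, w l
    set A := ∑ l, w l * ψ l
    set B := ∑ l, w l * ψ l ^ 2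
    have e1 : ∑ i, w i * (ψ i - A / C) ^ 2 = B - 2 * (A / C) * A + (A / C) ^ 2 * C := by
      simp only [A, B, C, Finset.mul_sum]
      rw [← Finset.sum_sub_distrib, ← Finset.sum_add_distrib]
      exact Finset.sum_congr rfl fun i _ => by ring
    have e2 : ∑ i, ∑ j, w i * w j / C * (ψ j - ψ i) ^ 2 = (C * B + B * C - 2 * (A * A)) / C := by
      have : C * B + B * C - 2 * (A * A) = ∑ i, ∑ j, w i * w j * (ψ j - ψ i) ^ 2 := by
        have b1 : C * B = ∑ i, ∑ j, w i * (w j * ψ j ^ 2) := Finset.sum_mul_sum _ _ _ _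
        have b2 : B * C = ∑ i, ∑ j, w i * ψ i ^ 2 * w j := Finset.sum_mul_sum _ _ _ _
        have b3 : A * A = ∑ i, ∑ j, w i * ψ i * (w j * ψ j) := Finset.sum_mul_sum _ _ _ _
        rw [b1, b2, b3, Finset.mul_sum, ← Finset.sum_add_distrib, ← Finset.sum_sub_distrib]
        refine Finset.sum_congr rfl fun i _ => ?_
        rw [Finset.mul_sum]
        rw [← Finset.sum_add_distrib, ← Finset.sum_sub_distrib]
        exact Finset.sum_congr rfl fun j _ => by ring
      rw [this]
      simp only [Finset.sum_div]
      exact Finset.sum_congr rfl fun i _ => Finset.sum_congr rfl fun j _ => by ring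
    rw [e1, e2]
    field_simp
    ring

/-- Extend `ψ` to vertex `0` by its weighted mean `h`, the minimizer of the energy at `0`. The star
at `0` then has exactly the energy of the added conductances. -/
theorem walkPoincare_reduced {c : Fin (n + 1) → Fin (n + 1) → ℝ} (hsymm : ∀ x y, c x y = c y x)
    (hc : ∀ x y, 0 ≤ c x y) {r : ℝ} (hr0 : 0 ≤ r) (hr : WalkPoincare c r) :
    WalkPoincare (reducedConductance c) r := by
  intro ψ hψ
  set w : Fin n → ℝ := fun i => c 0 i.succ with hw
  set h := (∑ l, w l * ψ l) / ∑ l, w l with hh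
  -- As `ψ` has zero sum, the mean of the extension is `h / (n + 1)`. After centering, the squared
  -- norm exceeds that of `ψ` by `h² n / (n + 1)`; `0 ≤ r` makes this harmless.
  have hmean : ∑ x : Fin (n + 1), ((Fin.cons h ψ : Fin (n + 1) → ℝ) x - h / (n + 1)) = 0 := by
    have : (n : ℝ) + 1 ≠ 0 := by positivity
    rw [Finset.sum_sub_distrib, Fin.sum_univ_succ]
    simp [hψ]
    field_simp
    ring
  have key := hr _ hmean
  have e1 : walkEnergy c (fun x => (Fin.cons h ψ : Fin (n + 1) → ℝ) x - h / (n + 1)) =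
      walkEnergy (reducedConductance c) ψ := by
    have hs := sum_sq_sub_weighted_mean (fun i => hc 0 i.succ) ψ
    have hs' : ∑ i, c 0 i.succ * (h - ψ i) ^ 2 = ∑ i, c 0 i.succ * (ψ i - h) ^ 2 :=
      Finset.sum_congr rfl fun i _ => by ring
    simp only [walkEnergy, Fin.sum_univ_succ (n := n), Fin.cons_zero, Fin.cons_succ,
      reducedConductance, add_mul, Finset.sum_add_distrib, sub_sub_sub_cancel_right, sub_self,
      hsymm _ 0, hs']
    linarith
  have e2 : ∑ x, ψ x ^ 2 ≤
      ∑ x, ((Fin.cons h ψ : Fin (n + 1) → ℝ) x - h / (n + 1)) ^ 2 := by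
    have hn : (0 : ℝ) < n + 1 := by positivity
    have : ∑ x, ((Fin.cons h ψ : Fin (n + 1) → ℝ) x - h / (n + 1)) ^ 2 =
        ∑ x, ψ x ^ 2 + h ^ 2 * (n / (n + 1)) := by
      simp only [Fin.sum_univ_succ, Fin.cons_zero, Fin.cons_succ, sub_sq, Finset.sum_add_distrib,
        Finset.sum_sub_distrib, ← Finset.sum_mul, ← Finset.mul_sum, hψ, Finset.sum_const,
        Finset.card_univ, Fintype.card_fin, nsmul_eq_mul, Nat.cast_add, Nat.cast_one]
      field_simp
      ring
    rw [this]
    have : 0 ≤ h ^ 2 * (n / (n + 1)) := by positivity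
    linarith
  calc r * ∑ x, ψ x ^ 2 ≤ _ := mul_le_mul_of_nonneg_left e2 hr0
    _ ≤ _ := key
    _ = _ := e1

theorem sum_config_succ (F : (Fin (n + 1) → Bool) → ℝ) :
    ∑ ζ, F ζ = ∑ η : Fin n → Bool, F (Fin.cons true η) + ∑ η : Fin n → Bool, F (Fin.cons false η) := by
  rw [← (Fin.consEquiv fun _ => Bool).sum_comp, Fintype.sum_prod_type, Fintype.sum_bool]
  rfl

theorem particleNumber_cons (b : Bool) (η : Fin n → Bool) :
    particleNumber (Fin.cons b η : Fin (n + 1) → Bool) = particleNumber η + b.toNat := by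
  simp [particleNumber, Fin.sum_univ_succ, add_comm]

theorem cons_comp_swap_succ (b : Bool) (η : Fin n → Bool) (i j : Fin n) :
    (Fin.cons b η : Fin (n + 1) → Bool) ∘ swap i.succ j.succ =
      (Fin.cons b (η ∘ swap i j) : Fin (n + 1) → Bool) := by
  funext x
  refine Fin.cases ?_ (fun l => ?_) x
  · simp [Equiv.swap_apply_of_ne_of_ne (Fin.succ_ne_zero i).symm (Fin.succ_ne_zero j).symm]
  · simp [← Function.Injective.map_swap (Fin.succ_injective n)]

theorem swapEnergy_succ (f : (Fin (n + 1) → Bool) → ℝ) (i j : Fin n) :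
    swapEnergy f i.succ j.succ = swapEnergy (fun η : Fin n → Bool => f (Fin.cons true η)) i j +
      swapEnergy (fun η : Fin n → Bool => f (Fin.cons false η)) i j := by
  simp only [swapEnergy, sum_config_succ, cons_comp_swap_succ]

/-- Swaps of vertices other than `0` act within each slice, so their energies add up. The octopus
inequality bounds the energy on the new conductances by that on the edges at `0`. -/
theorem exclusionEnergy_reduced_le {c : Fin (n + 1) → Fin (n + 1) → ℝ}
    (hsymm : ∀ x y, c x y = c y x) (hc : ∀ x y, 0 ≤ c x y) (f : (Fin (n + 1) → Bool) → ℝ) :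
    exclusionEnergy (reducedConductance c) (fun η => f (Fin.cons true η)) +
      exclusionEnergy (reducedConductance c) (fun η => f (Fin.cons false η)) ≤
      exclusionEnergy c f := by
  have h := octopus_fin (fun i => hc 0 i.succ) f
  have e : exclusionEnergy (reducedConductance c) (fun η => f (Fin.cons true η)) +
      exclusionEnergy (reducedConductance c) (fun η => f (Fin.cons false η)) =
      (∑ i : Fin n, ∑ j : Fin n, c i.succ j.succ * swapEnergy f i.succ j.succ +
      ∑ i : Fin n, ∑ j : Fin n, c 0 i.succ * c 0 j.succ / (∑ l : Fin n, c 0 l.succ) *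
        swapEnergy f i.succ j.succ) / 4 := by
    simp only [exclusionEnergy, ← add_div, ← Finset.sum_add_distrib, swapEnergy_succ,
      reducedConductance]
    congr 1
    exact Finset.sum_congr rfl fun x _ => Finset.sum_congr rfl fun y _ => by ring
  rw [e, exclusionEnergy]
  refine div_le_div_of_nonneg_right ?_ (by norm_num)
  simp only [Fin.sum_univ_succ (n := n), Finset.sum_add_distrib, swapEnergy_self,
    swapEnergy_comm f _ 0, hsymm _ 0] at h ⊢
  linarith

end Reduction

/-! ### The induction on the number of vertices. -/

theorem exclusionPoincare_fin (n : ℕ) : ∀ {c : Fin n → Fin n → ℝ}, (∀ x y, c x y = c y x) →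
    (∀ x y, 0 ≤ c x y) → ∀ {r : ℝ}, 0 ≤ r → WalkPoincare c r → ExclusionPoincare c r := by
  induction n with
  | zero =>
    intro c _ hc r _ _ f hf
    have h0 := hf 0
    have : ∀ ζ : Fin 0 → Bool, f ζ = 0 := by
      intro ζ
      simpa [particleNumber, Subsingleton.elim _ ζ] using h0
    simp [this, exclusionEnergy_nonneg hc]
  | succ n ih =>
    intro c hsymm hc r hr0 hr f hf
    have main := le_inner_of_forall_eigenvector (r := r) (exclusionOperator_isSymmetric c)
      (M := sumZero (Fin (n + 1))) (fun x _ => exclusionOperator_mem c x) ?_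
      (f := WithLp.toLp 2 f) hf
    · rw [inner_exclusionOperator, EuclideanSpace.norm_sq_eq] at main
      simpa using main
    intro g hg μ hμ
    -- Either `g` projects to a nonzero walk eigenfunction, or all one-site sums vanish and both
    -- slices at `0` qualify for the induction hypothesis.
    by_cases hx : ∃ k x, occupiedSum g k x ≠ 0
    · obtain ⟨k, x, hx⟩ := hx
      have := exclusionEnergy_eigenvector hsymm hr hg hμ hx
      rw [hμ, inner_smul_right, real_inner_self_eq_norm_sq]
      exact mul_le_mul_of_nonneg_right this (sq_nonneg _)
    · push Not at hx
      rw [inner_exclusionOperator, EuclideanSpace.norm_sq_eq]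
      simp only [Real.norm_eq_abs, sq_abs]
      rw [sum_config_succ, mul_add]
      refine le_trans (add_le_add ?_ ?_) (exclusionEnergy_reduced_le hsymm hc g)
      · refine ih (fun i j => ?_) (fun i j => ?_) hr0 (walkPoincare_reduced hsymm hc hr0 hr) _ ?_
        · rw [reducedConductance, reducedConductance, hsymm i.succ, mul_comm (c 0 i.succ)]
        · exact add_nonneg (hc _ _) (div_nonneg (mul_nonneg (hc _ _) (hc _ _))
            (Finset.sum_nonneg fun l _ => hc _ _))
        · intro k
          -- Occupying vertex `0` adds one particle to the `k` of the slice.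
          have h1 := hx (k + 1) 0
          rw [occupiedSum, sum_config_succ] at h1
          simpa [particleNumber_cons] using h1
      · refine ih (fun i j => ?_) (fun i j => ?_) hr0 (walkPoincare_reduced hsymm hc hr0 hr) _ ?_
        · rw [reducedConductance, reducedConductance, hsymm i.succ, mul_comm (c 0 i.succ)]
        · exact add_nonneg (hc _ _) (div_nonneg (mul_nonneg (hc _ _) (hc _ _))
            (Finset.sum_nonneg fun l _ => hc _ _))
        · intro k
          -- For the vacant slice, the occupied part is subtracted from the full sector sum.
          have h1 := hx k 0
          have h2 := hg k
          rw [occupiedSum, sum_config_succ] at h1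
          rw [sum_config_succ] at h2
          simp only [particleNumber_cons, Fin.cons_zero, and_true, Bool.false_eq_true, and_false,
            if_false, Finset.sum_const_zero, add_zero, Bool.toNat_false] at h1 h2
          rw [h1, zero_add] at h2
          exact h2

/-! ### Variational description of `spectralGap`. -/

section SpectralGap

variable {S : Type*} {L : (S → ℝ) →ₗ[ℝ] (S → ℝ)}

/-- The negative of `L`, as an operator on the Euclidean space of functions. -/
noncomputable def negEuclidean (L : (S → ℝ) →ₗ[ℝ] (S → ℝ)) :
    EuclideanSpace ℝ S →ₗ[ℝ] EuclideanSpace ℝ S :=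
  (WithLp.linearEquiv 2 ℝ (S → ℝ)).symm.conj (-L)

theorem negEuclidean_apply (f : EuclideanSpace ℝ S) (x : S) :
    negEuclidean L f x = -L (fun y => f y) x := rfl

variable [Fintype S]

theorem negEuclidean_isSymmetric (hL : ∀ f g : S → ℝ, ∑ x, f x * L g x = ∑ x, L f x * g x) :
    (negEuclidean L).IsSymmetric := by
  intro f g
  rw [PiLp.inner_apply, PiLp.inner_apply]
  change ∑ x, g x * -L (fun y => f y) x = ∑ x, -L (fun y => g y) x * f x
  simp only [mul_neg, neg_mul, Finset.sum_neg_distrib, hL]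

/-- `eigenvalues` is listed in decreasing order, so entry `1` of the increasing list has index
`Fin.rev 1`. -/
theorem spectralGap_eq_eigenvalues (hT : (negEuclidean L).IsSymmetric) {n : ℕ}
    (hn : Module.finrank ℝ (EuclideanSpace ℝ S) = n + 2) :
    spectralGap L = hT.eigenvalues hn (Fin.rev 1) := by
  have h : gapSpectrum L = List.ofFn (hT.eigenvalues hn ∘ Fin.rev) := by
    refine List.Perm.eq_of_sortedLE ?_ ?_ ?_
    · exact (Multiset.pairwise_sort _ _).sortedLE
    · exact ((hT.eigenvalues_antitone hn).comp Fin.rev_anti).sortedLE_ofFn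
    · have hc : (negEuclidean L).charpoly = (-L).charpoly := LinearEquiv.charpoly_conj _ _
      rw [← Multiset.coe_eq_coe, gapSpectrum, Multiset.sort_eq, ← hc,
        hT.roots_charpoly_eq_eigenvalues hn, ← Fin.univ_val_map]
      conv_lhs => rw [← Multiset.map_univ_val_equiv Fin.revPerm, Multiset.map_map]
      rfl
  rw [spectralGap, h]
  simp [List.getD_eq_getElem?_getD]

/-- The properties of the generator of a reversible Markov chain that are used below. -/
structure IsReversible (L : (S → ℝ) →ₗ[ℝ] (S → ℝ)) : Prop where
  symm : ∀ f g : S → ℝ, ∑ x, f x * L g x = ∑ x, L f x * g x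
  const : L (fun _ => 1) = 0
  nonpos : ∀ f : S → ℝ, ∑ x, f x * L f x ≤ 0

theorem IsReversible.sum_apply (hL : IsReversible L) (f : S → ℝ) : ∑ x, L f x = 0 := by
  have := hL.symm (fun _ => 1) f
  simpa [hL.const] using this

theorem exists_finrank_eq [Nontrivial S] :
    ∃ n, Module.finrank ℝ (EuclideanSpace ℝ S) = n + 2 := by
  rw [finrank_euclideanSpace]
  exact ⟨Fintype.card S - 2, by have := Fintype.one_lt_card (α := S); omega⟩

theorem inner_one (f : EuclideanSpace ℝ S) : ⟪WithLp.toLp 2 (fun _ => (1 : ℝ)), f⟫ = ∑ x, f x := by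
  rw [PiLp.inner_apply]
  simp

theorem negEuclidean_one (hL : IsReversible L) :
    negEuclidean L (WithLp.toLp 2 fun _ => (1 : ℝ)) = 0 := by
  ext x
  rw [negEuclidean_apply]
  change -L (fun _ => 1) x = 0
  rw [hL.const]
  simp

theorem eigenvalues_nonneg (hL : IsReversible L) (hT : (negEuclidean L).IsSymmetric) {n : ℕ}
    (hn : Module.finrank ℝ (EuclideanSpace ℝ S) = n) (i : Fin n) : 0 ≤ hT.eigenvalues hn i := by
  have h1 := hT.apply_eigenvectorBasis hn i
  have h2 : ‖hT.eigenvectorBasis hn i‖ = 1 := (hT.eigenvectorBasis hn).orthonormal.1 i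
  have h3 : 0 ≤ ⟪negEuclidean L (hT.eigenvectorBasis hn i), hT.eigenvectorBasis hn i⟫ := by
    rw [PiLp.inner_apply]
    change 0 ≤ ∑ x, hT.eigenvectorBasis hn i x * -L (fun y => hT.eigenvectorBasis hn i y) x
    simp only [mul_neg, Finset.sum_neg_distrib]
    exact neg_nonneg.2 (hL.nonpos _)
  rw [h1, inner_smul_left, real_inner_self_eq_norm_sq, h2] at h3
  simpa using h3

/-- If `μ < λ₁`, then `f` and the constant `1`, whose eigenvalues are at most `μ`, are both
multiples of the eigenvector for `λ₀`. Being orthogonal, one of them would be zero. -/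
theorem spectralGap_le_of_eigenvector [Nontrivial S] (hL : IsReversible L) {f : S → ℝ}
    (hf : f ≠ 0) (hsum : ∑ x, f x = 0) {μ : ℝ} (hμ : L f = -μ • f) : spectralGap L ≤ μ := by
  obtain ⟨n, hn⟩ := exists_finrank_eq (S := S)
  have hT := negEuclidean_isSymmetric hL.symm
  rw [spectralGap_eq_eigenvalues hT hn]
  set b := hT.eigenvectorBasis hn
  set ev := hT.eigenvalues hn
  have hb : ∀ i, negEuclidean L (b i) = ev i • b i := fun i => hT.apply_eigenvectorBasis hn i
  by_contra hlt
  push Not at hlt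
  have hμ0 : 0 ≤ μ := by
    have h := hL.nonpos f
    rw [hμ] at h
    have e : ∑ x, f x * (-μ • f) x = -(μ * ∑ x, f x ^ 2) := by
      rw [Finset.mul_sum, ← Finset.sum_neg_distrib]
      refine Finset.sum_congr rfl fun x _ => ?_
      simp only [Pi.smul_apply, smul_eq_mul]
      ring
    rw [e] at h
    obtain ⟨x, hx⟩ := Function.ne_iff.1 hf
    have hpos : 0 < ∑ x, f x ^ 2 :=
      Finset.sum_pos' (fun x _ => sq_nonneg _) ⟨x, Finset.mem_univ x, by
        have : f x ≠ 0 := hx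
        positivity⟩
    by_contra hneg
    push Not at hneg
    nlinarith
  have hbig : ∀ i : Fin (n + 2), i ≠ Fin.last (n + 1) → μ < ev i := by
    intro i hi
    refine hlt.trans_le (hT.eigenvalues_antitone hn ?_)
    rw [Fin.le_def, Fin.val_rev]
    have := Fin.val_lt_last hi
    simp
    omega
  have hzero : ∀ (g : EuclideanSpace ℝ S) (ν : ℝ), ν ≤ μ → negEuclidean L g = ν • g →
      g = ⟪b (Fin.last (n + 1)), g⟫ • b (Fin.last (n + 1)) := by
    intro g ν hν hg
    have hz : ∀ i : Fin (n + 2), i ≠ Fin.last (n + 1) → ⟪b i, g⟫ = 0 := by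
      intro i hi
      have h1 : ⟪negEuclidean L (b i), g⟫ = ⟪b i, negEuclidean L g⟫ := hT _ _
      rw [hb, hg, inner_smul_left, inner_smul_right, RCLike.conj_to_real] at h1
      have h2 : (ev i - ν) * ⟪b i, g⟫ = 0 := by linarith
      exact (mul_eq_zero.1 h2).resolve_left (by linarith [hbig i hi])
    conv_lhs => rw [← b.sum_repr' g]
    refine Finset.sum_eq_single _ (fun i _ hi => by rw [hz i hi, zero_smul]) (by simp)
  have h1 := hzero (WithLp.toLp 2 f) μ le_rfl (by
    ext x
    rw [negEuclidean_apply]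
    change -L f x = μ * f x
    rw [hμ]
    simp)
  have h2 := hzero (WithLp.toLp 2 fun _ => (1 : ℝ)) 0 hμ0 (by rw [negEuclidean_one hL, zero_smul])
  have h3 : ⟪WithLp.toLp 2 (fun _ : S => (1 : ℝ)), WithLp.toLp 2 f⟫ = 0 := by
    rw [inner_one]; exact hsum
  rw [h1, h2, inner_smul_left, inner_smul_right, real_inner_self_eq_norm_sq,
    b.orthonormal.1, RCLike.conj_to_real] at h3
  simp only [one_pow, mul_one, mul_eq_zero] at h3
  rcases h3 with h3 | h3
  · rw [h3, zero_smul] at h2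
    have := congrArg (fun g : EuclideanSpace ℝ S => g (Classical.arbitrary S)) h2
    simp at this
  · rw [h3, zero_smul] at h1
    refine hf (funext fun x => ?_)
    exact congrArg (fun g : EuclideanSpace ℝ S => g x) h1

theorem exists_eigenvector_spectralGap [Nontrivial S] (hL : IsReversible L) :
    ∃ f : S → ℝ, f ≠ 0 ∧ ∑ x, f x = 0 ∧ L f = -spectralGap L • f := by
  obtain ⟨n, hn⟩ := exists_finrank_eq (S := S)
  have hT := negEuclidean_isSymmetric hL.symm
  rw [spectralGap_eq_eigenvalues hT hn]
  have hnn := eigenvalues_nonneg hL hT hn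
  have anti := hT.eigenvalues_antitone hn
  set b := hT.eigenvectorBasis hn
  set ev := hT.eigenvalues hn
  have hb : ∀ i, negEuclidean L (b i) = ev i • b i := fun i => hT.apply_eigenvectorBasis hn i
  have hbne : ∀ i, b i ≠ 0 := fun i => b.orthonormal.ne_zero i
  set one : EuclideanSpace ℝ S := WithLp.toLp 2 fun _ => (1 : ℝ)
  set p : Fin (n + 2) := Fin.rev 1
  set l : Fin (n + 2) := Fin.last (n + 1)
  have hpl : p ≠ l := by
    intro h
    have := congrArg Fin.val h
    simp [p, l, Fin.val_rev] at this
  suffices h : ∃ f : EuclideanSpace ℝ S, f ≠ 0 ∧ ⟪one, f⟫ = 0 ∧ negEuclidean L f = ev p • f by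
    obtain ⟨f, hf, h1, h2⟩ := h
    refine ⟨fun x => f x, fun h => hf ?_, by rw [← inner_one]; exact h1, ?_⟩
    · ext x; exact congrFun h x
    · funext x
      have := congrArg (fun g : EuclideanSpace ℝ S => g x) h2
      simp only [negEuclidean_apply, PiLp.smul_apply, smul_eq_mul] at this
      simp only [Pi.smul_apply, smul_eq_mul]
      linarith
  -- If `λ₁ = 0`, the eigenvectors for `λ₀` and `λ₁` span a plane in the kernel, which contains a
  -- nonzero vector orthogonal to `1`. If `λ₁ > 0`, its eigenvector is already orthogonal to the
  -- kernel vector `1`.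
  rcases (hnn p).eq_or_lt with h0 | h0
  · have hl : ev l = 0 := le_antisymm (h0 ▸ anti (Fin.le_last p)) (hnn l)
    by_cases hz : ⟪one, b l⟫ = 0
    · exact ⟨b l, hbne l, hz, by rw [hb, hl, ← h0]⟩
    · refine ⟨⟪one, b l⟫ • b p - ⟪one, b p⟫ • b l, fun h => hz ?_, ?_, ?_⟩
      · have := congrArg (fun g => ⟪b p, g⟫) h
        simpa [inner_sub_right, inner_smul_right, b.inner_eq_zero hpl,
          real_inner_self_eq_norm_sq, b.orthonormal.1] using this
      · rw [inner_sub_right, inner_smul_right, inner_smul_right]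
        ring
      · rw [map_sub, map_smul, map_smul, hb, hb, hl, ← h0]
        simp
  · refine ⟨b p, hbne p, ?_, hb p⟩
    have h1 : ⟪negEuclidean L one, b p⟫ = ⟪one, negEuclidean L (b p)⟫ := hT _ _
    rw [negEuclidean_one hL, hb, inner_zero_left, inner_smul_right] at h1
    exact (mul_eq_zero.1 h1.symm).resolve_left h0.ne'

theorem spectralGap_mul_le [Nontrivial S] (hL : IsReversible L) {f : S → ℝ}
    (hf : ∑ x, f x = 0) : spectralGap L * ∑ x, f x ^ 2 ≤ -∑ x, f x * L f x := by
  have hT := negEuclidean_isSymmetric hL.symm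
  set one : EuclideanSpace ℝ S := WithLp.toLp 2 fun _ => (1 : ℝ)
  have key := le_inner_of_forall_eigenvector (r := spectralGap L) hT
    (M := LinearMap.ker (innerₗ (EuclideanSpace ℝ S) one)) (f := WithLp.toLp 2 f) ?_ ?_ ?_
  · rw [EuclideanSpace.norm_sq_eq, real_inner_comm, PiLp.inner_apply] at key
    have e : ∑ x, inner ℝ ((negEuclidean L (WithLp.toLp 2 f)) x) ((WithLp.toLp 2 f) x) =
        -∑ x, f x * L f x := by
      rw [← Finset.sum_neg_distrib]
      refine Finset.sum_congr rfl fun x _ => ?_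
      change f x * -L f x = _
      ring
    rw [e] at key
    simpa using key
  · intro g _
    rw [LinearMap.mem_ker, innerₗ_apply_apply, ← hT, negEuclidean_one hL, inner_zero_left]
  · intro g hg μ hμ
    rw [LinearMap.mem_ker, innerₗ_apply_apply, inner_one] at hg
    rw [hμ, inner_smul_right, real_inner_self_eq_norm_sq]
    rcases eq_or_ne g 0 with rfl | hg0
    · simp
    refine mul_le_mul_of_nonneg_right ?_ (sq_nonneg _)
    refine spectralGap_le_of_eigenvector hL (f := fun x => g x) (fun h => hg0 ?_) hg ?_
    · ext x; exact congrFun h x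
    · funext x
      have := congrArg (fun g : EuclideanSpace ℝ S => g x) hμ
      simp only [negEuclidean_apply, PiLp.smul_apply, smul_eq_mul] at this
      simp only [Pi.smul_apply, smul_eq_mul]
      linarith
  · rw [LinearMap.mem_ker, innerₗ_apply_apply, inner_one]
    exact hf

end SpectralGap

/-! ### From the weighted graph to symmetric conductances on configurations. -/

section Conductance

variable {V : Type*} [DecidableEq V]

/-- The configuration with occupied set `s`. -/
def toConfig (s : Finset V) : V → Bool := fun x => decide (x ∈ s)

theorem toConfig_exchangePair (s : Finset V) (x y : V) :
    toConfig (exchangePair s x y) = toConfig s ∘ swap x y := by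
  funext v
  simp only [toConfig, Function.comp_apply, exchangePair, Equiv.swap_apply_def]
  split_ifs <;> simp_all
  all_goals grind

/-- The conductances as a matrix with zero diagonal. -/
def WeightedGraph.conductance (G : WeightedGraph V) (x y : V) : ℝ :=
  if x = y then 0 else G.c s(x, y)

theorem WeightedGraph.conductance_comm (G : WeightedGraph V) (x y : V) :
    G.conductance x y = G.conductance y x := by
  simp only [WeightedGraph.conductance, eq_comm (a := x), Sym2.eq_swap (a := x)]

theorem WeightedGraph.conductance_nonneg (G : WeightedGraph V) (x y : V) :
    0 ≤ G.conductance x y := by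
  unfold WeightedGraph.conductance
  split_ifs with h
  · rfl
  · exact G.nonneg x y h

end Conductance

section Transport

variable {V : Type*} [Fintype V] [DecidableEq V]

theorem exclusionPoincare_of_walkPoincare {c : V → V → ℝ} (hsymm : ∀ x y, c x y = c y x)
    (hc : ∀ x y, 0 ≤ c x y) {r : ℝ} (hr0 : 0 ≤ r) (hr : WalkPoincare c r) :
    ExclusionPoincare c r := by
  set e := Fintype.equivFin V
  intro f hf
  have hw : WalkPoincare (fun i j => c (e.symm i) (e.symm j)) r := by
    intro φ hφ
    have h := hr (fun x => φ (e x)) (by rw [← hφ]; exact e.sum_comp φ)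
    rw [e.sum_comp fun i => φ i ^ 2] at h
    refine h.trans_eq ?_
    rw [walkEnergy, walkEnergy, ← e.symm.sum_comp]
    congr 1
    refine Finset.sum_congr rfl fun i _ => ?_
    rw [← e.symm.sum_comp]
    simp
  have hsum : ∀ F : (V → Bool) → ℝ,
      ∑ η : Fin (Fintype.card V) → Bool, F (η ∘ e) = ∑ ζ, F ζ := fun F =>
    (Equiv.arrowCongr e.symm (Equiv.refl Bool)).sum_comp F
  have hnum : ∀ η : Fin (Fintype.card V) → Bool, particleNumber (η ∘ e) = particleNumber η :=
    fun η => e.sum_comp fun i => (η i).toNat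
  have h := exclusionPoincare_fin _ (fun i j => hsymm _ _) (fun i j => hc _ _) hr0 hw
    (fun η => f (η ∘ e)) (fun k => by
      have h := hf k
      rw [← hsum] at h
      simpa only [hnum] using h)
  rw [hsum fun ζ => f ζ ^ 2] at h
  refine h.trans_eq ?_
  have hE : ∀ i j, swapEnergy (fun η : Fin (Fintype.card V) → Bool => f (η ∘ e)) i j =
      swapEnergy f (e.symm i) (e.symm j) := by
    intro i j
    rw [swapEnergy, swapEnergy, ← hsum]
    refine Finset.sum_congr rfl fun η _ => ?_
    congr 3
    funext x
    simp only [Function.comp_apply]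
    congr 1
    rw [← e.symm.injective.eq_iff, e.symm_apply_apply,
      e.symm.injective.map_swap, e.symm_apply_apply]
  rw [exclusionEnergy, exclusionEnergy]
  simp only [hE]
  congr 1
  rw [e.symm.sum_comp fun x => ∑ j, c x (e.symm j) * swapEnergy f x (e.symm j)]
  refine Finset.sum_congr rfl fun x _ => ?_
  exact e.symm.sum_comp fun y => c x y * swapEnergy f x y

theorem particleNumber_toConfig (s : Finset V) : particleNumber (toConfig s) = s.card := by
  have h : ∀ x, (toConfig s x).toNat = if x ∈ s then 1 else 0 := fun x => by
    unfold toConfig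
    split_ifs with hx <;> simp [hx]
  simp [particleNumber, h]

/-- Configurations correspond to sets of occupied vertices. -/
def configEquiv (V : Type*) [Fintype V] [DecidableEq V] : Finset V ≃ (V → Bool) where
  toFun := toConfig
  invFun ζ := Finset.univ.filter fun x => ζ x = true
  left_inv s := by ext x; simp [toConfig]
  right_inv ζ := by funext x; simp [toConfig]

theorem sum_exclusionState {k : ℕ} (F : (V → Bool) → ℝ) (hF : ∀ ζ, particleNumber ζ ≠ k → F ζ = 0) :
    ∑ s : ExclusionState V k, F (toConfig s.1) = ∑ ζ, F ζ := by
  rw [← (configEquiv V).sum_comp]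
  change _ = ∑ s, F (toConfig s)
  rw [← Finset.sum_filter_of_ne (p := fun s : Finset V => s.card = k)]
  · exact (Finset.sum_subtype _ (by simp) fun s => F (toConfig s)).symm
  · intro s _ hs
    by_contra hcard
    exact hs (hF _ (by rwa [particleNumber_toConfig]))

/-- Extension by zero of a function of the states of the `k`-particle process. -/
def extendConfig {k : ℕ} (f : ExclusionState V k → ℝ) (ζ : V → Bool) : ℝ :=
  if h : ((configEquiv V).symm ζ).card = k then f ⟨(configEquiv V).symm ζ, h⟩ else 0

theorem extendConfig_toConfig {k : ℕ} (f : ExclusionState V k → ℝ) (s : ExclusionState V k) :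
    extendConfig f (toConfig s.1) = f s := by
  have h : (configEquiv V).symm (toConfig s.1) = s.1 := (configEquiv V).symm_apply_apply s.1
  simp only [extendConfig, h, s.2, dif_pos]

theorem extendConfig_eq_zero {k : ℕ} (f : ExclusionState V k → ℝ) {ζ : V → Bool}
    (hζ : particleNumber ζ ≠ k) : extendConfig f ζ = 0 := by
  rw [extendConfig, dif_neg]
  intro h
  refine hζ ?_
  rw [← h, ← particleNumber_toConfig]
  exact congrArg _ ((configEquiv V).apply_symm_apply ζ).symm

theorem two_mul_sum_edges (H : Sym2 V → ℝ) :
    2 * ∑ e ∈ (⊤ : SimpleGraph V).edgeFinset, H e =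
      ∑ x, ∑ y, if x = y then 0 else H s(x, y) := by
  have h1 : ∑ x, ∑ y, (if x = y then 0 else H s(x, y)) =
      ∑ p ∈ Finset.univ.filter (fun p : V × V => p.1 ≠ p.2), H s(p.1, p.2) := by
    rw [Finset.sum_filter, Fintype.sum_prod_type]
    simp only [ne_eq, ite_not]
  rw [h1, ← Finset.sum_fiberwise_of_maps_to (g := fun p : V × V => s(p.1, p.2))
    (t := (⊤ : SimpleGraph V).edgeFinset) (by simp), Finset.mul_sum]
  refine Finset.sum_congr rfl fun e he => ?_
  induction e using Sym2.ind with
  | _ x y =>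
    have hxy : x ≠ y := by simpa using he
    have hfib : (Finset.univ.filter fun p : V × V => p.1 ≠ p.2).filter
        (fun p => s(p.1, p.2) = s(x, y)) = {(x, y), (y, x)} := by
      ext ⟨a, b⟩
      simp only [Finset.mem_filter, Finset.mem_univ, true_and, Sym2.eq_iff, Finset.mem_insert,
        Finset.mem_singleton, Prod.mk.injEq]
      constructor
      · exact fun h => h.2
      · rintro (⟨rfl, rfl⟩ | ⟨rfl, rfl⟩)
        · exact ⟨hxy, Or.inl ⟨rfl, rfl⟩⟩
        · exact ⟨hxy.symm, Or.inr ⟨rfl, rfl⟩⟩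
    rw [hfib, Finset.sum_pair (by simp [hxy]), Sym2.eq_swap (a := y)]
    ring

theorem WeightedGraph.randomWalkGenerator_apply (G : WeightedGraph V) (f : V → ℝ) (x : V) :
    G.randomWalkGenerator f x = -∑ y, G.conductance x y * (f x - f y) := by
  change ∑ y ∈ Finset.univ.erase x, G.c s(x, y) * (f y - f x) = _
  rw [← Finset.sum_neg_distrib, ← Finset.add_sum_erase _ _ (Finset.mem_univ x), sub_self, mul_zero,
    neg_zero, zero_add]
  refine Finset.sum_congr rfl fun y hy => ?_
  rw [WeightedGraph.conductance, if_neg (Finset.ne_of_mem_erase hy).symm]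
  ring

theorem WeightedGraph.sum_mul_randomWalkGenerator (G : WeightedGraph V) (f : V → ℝ) :
    ∑ x, f x * G.randomWalkGenerator f x = -walkEnergy G.conductance f := by
  rw [walkEnergy_eq G.conductance_comm, ← Finset.sum_neg_distrib]
  refine Finset.sum_congr rfl fun x _ => ?_
  rw [G.randomWalkGenerator_apply, mul_neg]

theorem WeightedGraph.isReversible_randomWalk (G : WeightedGraph V) :
    IsReversible G.randomWalkGenerator where
  symm f g := by
    simp only [G.randomWalkGenerator_apply, mul_neg, neg_mul, Finset.sum_neg_distrib, neg_inj,
      Finset.mul_sum, Finset.sum_mul, mul_sub, sub_mul, Finset.sum_sub_distrib]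
    congr 1
    · exact Finset.sum_congr rfl fun x _ => Finset.sum_congr rfl fun y _ => by ring
    · rw [Finset.sum_comm]
      refine Finset.sum_congr rfl fun x _ => Finset.sum_congr rfl fun y _ => ?_
      rw [G.conductance_comm]
      ring
  const := by
    funext x
    simp [G.randomWalkGenerator_apply]
  nonpos f := by
    rw [G.sum_mul_randomWalkGenerator, neg_nonpos]
    exact div_nonneg (Finset.sum_nonneg fun x _ => Finset.sum_nonneg fun y _ =>
      mul_nonneg (G.conductance_nonneg x y) (sq_nonneg _)) zero_le_two

/-- Any extension `F` of `f` is allowed, because swaps preserve the number of particles; zero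
extensions, constants and lifts are all used. -/
theorem WeightedGraph.exclusionGenerator_apply (G : WeightedGraph V) {k : ℕ}
    (f : ExclusionState V k → ℝ) (F : (V → Bool) → ℝ) (hF : ∀ s, F (toConfig s.1) = f s)
    (s : ExclusionState V k) : G.exclusionGenerator k f s =
      -((∑ x, ∑ y, G.conductance x y * (F (toConfig s.1) - F (toConfig s.1 ∘ swap x y))) / 2) := by
  change ∑ e ∈ (⊤ : SimpleGraph V).edgeFinset, G.c e * (f (exchange s e) - f s) = _
  have h := two_mul_sum_edges fun e => G.c e * (f (exchange s e) - f s)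
  have e : (∑ x, ∑ y, if x = y then 0 else G.c s(x, y) * (f (exchange s s(x, y)) - f s)) =
      -∑ x, ∑ y, G.conductance x y * (F (toConfig s.1) - F (toConfig s.1 ∘ swap x y)) := by
    rw [← Finset.sum_neg_distrib]
    refine Finset.sum_congr rfl fun x _ => ?_
    rw [← Finset.sum_neg_distrib]
    refine Finset.sum_congr rfl fun y _ => ?_
    rw [WeightedGraph.conductance, ← toConfig_exchangePair, hF, ← hF (exchange s s(x, y))]
    change _ = -(_ * (_ - F (toConfig (exchange s s(x, y)).1)))
    split_ifs
    · ring
    · ring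
  rw [e] at h
  linarith

theorem WeightedGraph.sum_mul_exclusionGenerator (G : WeightedGraph V) {k : ℕ}
    (f g : ExclusionState V k → ℝ) : ∑ s, f s * G.exclusionGenerator k g s =
      -⟪(WithLp.toLp 2 (extendConfig f) : EuclideanSpace ℝ (V → Bool)),
        exclusionOperator G.conductance (WithLp.toLp 2 (extendConfig g))⟫ := by
  rw [real_inner_comm, PiLp.inner_apply]
  change _ = -∑ ζ, extendConfig f ζ *
    exclusionOperator G.conductance (WithLp.toLp 2 (extendConfig g)) ζ
  rw [← sum_exclusionState (k := k)]
  · rw [← Finset.sum_neg_distrib]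
    refine Finset.sum_congr rfl fun s _ => ?_
    rw [G.exclusionGenerator_apply g (extendConfig g) (extendConfig_toConfig g),
      extendConfig_toConfig f, exclusionOperator_apply]
    ring
  · intro ζ hζ
    rw [extendConfig_eq_zero f hζ, zero_mul]

theorem WeightedGraph.isReversible_exclusion (G : WeightedGraph V) (k : ℕ) :
    IsReversible (G.exclusionGenerator k) where
  symm f g := by
    rw [G.sum_mul_exclusionGenerator, ← exclusionOperator_isSymmetric, real_inner_comm,
      ← G.sum_mul_exclusionGenerator]
    exact Finset.sum_congr rfl fun s _ => mul_comm _ _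
  const := by
    funext s
    rw [G.exclusionGenerator_apply (fun _ => 1) (fun _ => 1) (fun _ => rfl)]
    simp
  nonpos f := by
    rw [G.sum_mul_exclusionGenerator, inner_exclusionOperator, neg_nonpos]
    exact exclusionEnergy_nonneg G.conductance_nonneg _

end Transport

/-! ### The two inequalities between the gaps. -/

section MainTheorem

variable {V : Type*} [Fintype V] [DecidableEq V]

/-- A zero-sum gap eigenfunction of the `k`-particle process, extended by zero, is a test function
for the Poincaré inequality in all sectors with the walk gap as constant. -/
theorem le_spectralGap_exclusion [Nontrivial V] (G : WeightedGraph V) (k : ℕ)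
    [Nontrivial (ExclusionState V k)] :
    spectralGap G.randomWalkGenerator ≤ spectralGap (G.exclusionGenerator k) := by
  set r := spectralGap G.randomWalkGenerator
  have hpos : ∀ {S : Type _} [Fintype S] {f : S → ℝ}, f ≠ 0 → 0 < ∑ x, f x ^ 2 := by
    intro S _ f hf
    obtain ⟨x, hx⟩ := Function.ne_iff.1 hf
    have : f x ≠ 0 := hx
    exact Finset.sum_pos' (fun x _ => sq_nonneg _) ⟨x, Finset.mem_univ x, by positivity⟩
  have hr : WalkPoincare G.conductance r := by
    intro φ hφ
    have := spectralGap_mul_le G.isReversible_randomWalk hφ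
    rwa [G.sum_mul_randomWalkGenerator, neg_neg] at this
  have hr0 : 0 ≤ r := by
    obtain ⟨φ, hφ0, -, hφ⟩ := exists_eigenvector_spectralGap G.isReversible_randomWalk
    have h := G.isReversible_randomWalk.nonpos φ
    rw [hφ] at h
    have e : ∑ x, φ x * (-r • φ) x = -(r * ∑ x, φ x ^ 2) := by
      rw [Finset.mul_sum, ← Finset.sum_neg_distrib]
      refine Finset.sum_congr rfl fun x _ => ?_
      simp only [Pi.smul_apply, smul_eq_mul]
      ring
    rw [e, neg_nonpos] at h
    exact nonneg_of_mul_nonneg_left h (hpos hφ0)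
  obtain ⟨f, hf0, hfsum, hf⟩ := exists_eigenvector_spectralGap (G.isReversible_exclusion k)
  set m := spectralGap (G.exclusionGenerator k)
  have h := exclusionPoincare_of_walkPoincare G.conductance_comm G.conductance_nonneg hr0 hr
    (extendConfig f) (fun j => by
      rcases eq_or_ne j k with rfl | hj
      · refine Eq.trans ?_ hfsum
        rw [← sum_exclusionState (k := j)]
        · refine Finset.sum_congr rfl fun s _ => ?_
          rw [if_pos (by rw [particleNumber_toConfig, s.2]), extendConfig_toConfig]
        · intro ζ hζ
          rw [if_neg hζ]
      · refine Finset.sum_eq_zero fun ζ _ => ?_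
        split_ifs with hζ
        · exact extendConfig_eq_zero f (by rw [hζ]; exact hj)
        · rfl)
  rw [← sum_exclusionState (k := k) (fun ζ => extendConfig f ζ ^ 2)
    (fun ζ hζ => by rw [extendConfig_eq_zero f hζ]; ring)] at h
  simp only [extendConfig_toConfig] at h
  have hE := G.sum_mul_exclusionGenerator f f
  rw [inner_exclusionOperator, hf] at hE
  have e : ∑ x, f x * (-m • f) x = -(m * ∑ x, f x ^ 2) := by
    rw [Finset.mul_sum, ← Finset.sum_neg_distrib]
    refine Finset.sum_congr rfl fun x _ => ?_
    simp only [Pi.smul_apply, smul_eq_mul]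
    ring
  rw [e, neg_inj] at hE
  change r * ∑ s, f s ^ 2 ≤ exclusionEnergy G.conductance (extendConfig f) at h
  rw [← show _ = exclusionEnergy G.conductance (extendConfig f) from hE] at h
  exact le_of_mul_le_mul_right h (hpos hf0)

theorem exists_exchangeable_state {k : ℕ} (hk : 1 ≤ k) (hkn : k ≤ Fintype.card V - 1) {x y : V}
    (hxy : x ≠ y) : ∃ s : ExclusionState V k, x ∈ s.1 ∧ y ∉ s.1 := by
  have hcard : ({x, y}ᶜ : Finset V).card = Fintype.card V - 2 := by
    rw [Finset.card_compl, Finset.card_pair hxy]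
  obtain ⟨t, ht, htc⟩ := Finset.exists_subset_card_eq (s := ({x, y}ᶜ : Finset V)) (n := k - 1)
    (by omega)
  have hx : x ∉ t := fun h => by simpa using ht h
  have hy : y ∉ t := fun h => by simpa using ht h
  refine ⟨⟨insert x t, ?_⟩, Finset.mem_insert_self _ _, ?_⟩
  · rw [Finset.card_insert_of_notMem hx]; omega
  · simp [hy, hxy.symm]

/-- The lift of a function of one particle to configurations. -/
def configLift (φ : V → ℝ) (ζ : V → Bool) : ℝ := ∑ v, if ζ v = true then φ v else 0

theorem configLift_sub (φ : V → ℝ) (ζ : V → Bool) (x y : V) :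
    configLift φ ζ - configLift φ (ζ ∘ swap x y) =
      ∑ v, if ζ v = true then φ v - φ (swap x y v) else 0 := by
  have h : configLift φ (ζ ∘ swap x y) = ∑ v, if ζ v = true then φ (swap x y v) else 0 := by
    rw [configLift, ← Equiv.sum_comp (swap x y)]
    simp
  rw [h, configLift, ← Finset.sum_sub_distrib]
  exact Finset.sum_congr rfl fun v _ => by split_ifs <;> simp

/-- A swap changes the lift by the sum, over occupied sites, of the change of `φ` there; summing
over pairs site by site gives the walk generator. -/
theorem exclusionGenerator_configLift (G : WeightedGraph V) {k : ℕ} (φ : V → ℝ)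
    (s : ExclusionState V k) :
    G.exclusionGenerator k (fun s => configLift φ (toConfig s.1)) s =
      configLift (G.randomWalkGenerator φ) (toConfig s.1) := by
  rw [G.exclusionGenerator_apply _ (configLift φ) (fun _ => rfl)]
  have h : ∀ v, (if toConfig s.1 v = true then G.randomWalkGenerator φ v else 0) =
      ∑ x, ∑ y, -(G.conductance x y *
        (if toConfig s.1 v = true then φ v - φ (swap x y v) else 0) / 2) := by
    intro v
    rw [G.randomWalkGenerator_apply, ← sum_sub_swap G.conductance_comm]
    simp only [Finset.sum_neg_distrib, Finset.sum_div]
    split_ifs <;> simp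
  simp only [configLift_sub]
  rw [configLift]
  simp only [h]
  symm
  rw [Finset.sum_comm, Finset.sum_div, ← Finset.sum_neg_distrib]
  refine Finset.sum_congr rfl fun x _ => ?_
  rw [Finset.sum_comm, Finset.sum_div, ← Finset.sum_neg_distrib]
  refine Finset.sum_congr rfl fun y _ => ?_
  rw [Finset.mul_sum, Finset.sum_div, ← Finset.sum_neg_distrib]

theorem spectralGap_exclusion_le [Nontrivial V] (G : WeightedGraph V) {k : ℕ} (hk : 1 ≤ k)
    (hkn : k ≤ Fintype.card V - 1) [Nontrivial (ExclusionState V k)] :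
    spectralGap (G.exclusionGenerator k) ≤ spectralGap G.randomWalkGenerator := by
  obtain ⟨φ, hφ0, hφsum, hφ⟩ := exists_eigenvector_spectralGap G.isReversible_randomWalk
  set r := spectralGap G.randomWalkGenerator
  obtain ⟨x, y, hne⟩ : ∃ x y, φ x ≠ φ y := by
    by_contra hall
    push Not at hall
    refine hφ0 (funext fun x => ?_)
    have : ∑ y, φ y = Fintype.card V * φ x := by
      rw [Finset.sum_congr rfl fun y _ => hall y x]
      simp
    rw [hφsum] at this
    have hcard : (Fintype.card V : ℝ) ≠ 0 := by exact_mod_cast Fintype.card_ne_zero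
    exact (mul_eq_zero.1 this.symm).resolve_left hcard
  obtain ⟨s, hxs, hys⟩ := exists_exchangeable_state hk hkn
    (fun h => hne (congrArg φ h) : x ≠ y)
  set F : ExclusionState V k → ℝ := fun s => configLift φ (toConfig s.1) with hF
  have hLF : G.exclusionGenerator k F = -r • F := by
    funext t
    rw [hF, exclusionGenerator_configLift, hφ]
    simp only [Pi.smul_apply, smul_eq_mul, configLift, Finset.mul_sum]
    exact Finset.sum_congr rfl fun v _ => by split_ifs <;> simp
  -- The generator has zero total sum, so the mean `a` below satisfies `r * a = 0`. Centering `F`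
  -- therefore preserves the eigenvalue equation, including when `r = 0`.
  have hsum : r * ∑ t, F t = 0 := by
    have := (G.isReversible_exclusion k).sum_apply F
    rw [hLF] at this
    simp only [Pi.smul_apply, smul_eq_mul, ← Finset.mul_sum] at this
    linarith
  -- Moving a particle from `x` to `y` changes `F` by `φ y - φ x ≠ 0`, so `F` is not constant and
  -- its centering is nonzero.
  have hFne : F (exchange s s(x, y)) ≠ F s := by
    intro h
    have h1 := configLift_sub φ (toConfig s.1) x y
    rw [← toConfig_exchangePair] at h1
    change F s - F (exchange s s(x, y)) = _ at h1
    rw [h, sub_self, Finset.sum_eq_single x] at h1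
    · simp [toConfig, hxs] at h1
      exact hne (by linarith)
    · intro v _ hv
      split_ifs with hvs
      · have : v ≠ y := by
          rintro rfl
          simp [toConfig, hys] at hvs
        rw [Equiv.swap_apply_of_ne_of_ne hv this, sub_self]
      · rfl
    · simp
  set a := (∑ t, F t) / Fintype.card (ExclusionState V k)
  have hcard : (Fintype.card (ExclusionState V k) : ℝ) ≠ 0 := by
    exact_mod_cast Fintype.card_ne_zero
  refine spectralGap_le_of_eigenvector (G.isReversible_exclusion k)
    (f := fun t => F t - a) (fun h => hFne ?_) ?_ ?_
  · have h1 := congrFun h s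
    have h2 := congrFun h (exchange s s(x, y))
    simp only [Pi.zero_apply] at h1 h2
    linarith
  · rw [Finset.sum_sub_distrib, Finset.sum_const, Finset.card_univ, nsmul_eq_mul,
      mul_div_cancel₀ _ hcard, sub_self]
  · have e : (fun t => F t - a) = F - a • fun _ => (1 : ℝ) := by
      funext t
      simp
    have ha : r * a = 0 := by rw [← mul_div_assoc, hsum, zero_div]
    rw [e, map_sub, map_smul, (G.isReversible_exclusion k).const, hLF]
    funext t
    simp only [Pi.sub_apply, Pi.smul_apply, smul_eq_mul, Pi.zero_apply]
    linarith

end MainTheorem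

theorem mainTheorem5 {V : Type*} [Fintype V] [DecidableEq V] (G : WeightedGraph V)
    (k : ℕ) (hk : 1 ≤ k) (hkn : k ≤ Fintype.card V - 1) :
    spectralGap (G.exclusionGenerator k) = spectralGap G.randomWalkGenerator := by
  have hV : Nontrivial V := Fintype.one_lt_card_iff_nontrivial.1 (by omega)
  have hS : Nontrivial (ExclusionState V k) := by
    obtain ⟨x, y, hxy⟩ := exists_pair_ne V
    obtain ⟨s, hs, -⟩ := exists_exchangeable_state hk hkn hxy
    obtain ⟨t, -, ht⟩ := exists_exchangeable_state hk hkn hxy.symm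
    exact ⟨s, t, fun h => ht (h ▸ hs)⟩
  exact le_antisymm (spectralGap_exclusion_le G hk hkn) (le_spectralGap_exclusion G k)
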